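/- **Psyquandles.** A \emph{biquandle} is a set $X$ with operations $\underline{\triangleright},\overline{\triangleright}$ such that (i) $x\,\underline{\triangleright}\,x=x\,\overline{\triangleright}\,x$; (ii) for all $y$ the maps $x\mapsto x\,\overline{\triangleright}\,y$ and $x\mapsto x\,\underline{\triangleright}\,y$, and the map $S(x,y)=(y\,\overline{\triangleright}\,x,\;x\,\underline{\triangleright}\,y)$, are bijective; (iii) the exchange laws hold: $$(x\underline{\triangleright}y)\underline{\triangleright}(z\underline{\triangleright}y)=(x\underline{\triangleright}z)\underline{\triangleright}(y\overline{\triangleright}z),\quad (x\underline{\triangleright}y)\overline{\triangleright}(z\underline{\triangleright}y)=(x\overline{\triangleright}z)\underline{\triangleright}(y\overline{\triangleright}z),\quad (x\overline{\triangleright}y)\overline{\triangleright}(z\overline{\triangleright}y)=(x\overline{\triangleright}z)\overline{\triangleright}(y\underline{\triangleright}z).$$ A \emph{psyquandle} is a biquandle with two more operations $\underline{\bullet},\overline{\bullet}$ such that for all $y$ the maps $x\mapsto x\,\overline{\bullet}\,y$ and $x\mapsto x\,\underline{\bullet}\,y$, and the map $S'(x,y)=(y\,\overline{\bullet}\,x,\;x\,\underline{\bullet}\,y)$,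 are bijective; for all $x,y$ there is a unique pair $(w,z)$ with $$x\underline{\triangleright}y=z\overline{\bullet}y,\quad y\overline{\triangleright}x=w\overline{\bullet}x,\quad w\underline{\triangleright}z=y\underline{\bullet}z,\quad z\overline{\triangleright}w=x\underline{\bullet}w;$$ and the mixed exchange laws hold: $$(x\overline{\triangleright}y)\overline{\triangleright}(z\overline{\bullet}y)=(x\overline{\triangleright}z)\overline{\triangleright}(y\underline{\bullet}z),\quad (x\underline{\triangleright}y)\underline{\triangleright}(z\overline{\bullet}y)=(x\underline{\triangleright}z)\underline{\triangleright}(y\underline{\bullet}z),$$ $$(x\overline{\triangleright}y)\overline{\bullet}(z\overline{\triangleright}y)=(x\overline{\bullet}z)\overline{\triangleright}(y\underline{\triangleright}z),\quad (x\underline{\triangleright}y)\underline{\bullet}(z\underline{\triangleright}y)=(x\underline{\bullet}z)\underline{\triangleright}(y\overline{\triangleright}z),$$ $$(x\overline{\triangleright}y)\underline{\bullet}(z\overline{\triangleright}y)=(x\underline{\bullet}z)\overline{\triangleright}(y\underline{\triangleright}z),\quad (x\underline{\triangleright}y)\overline{\bullet}(z\underline{\triangleright}y)=(x\overline{\bullet}z)\underline{\triangleright}(y\overline{\triangleright}z).$$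 It is \emph{pI-adequate} if moreover $x\,\underline{\bullet}\,x=x\,\overline{\bullet}\,x$ for all $x$. Isomorphisms are bijections that respect the four operations. **Diagrams and links.** A diagram is an oriented planar link diagram whose crossings are positive, negative or flat, both strands passing straight through each crossing. Flat crossings are the singular crossings of a singular link diagram, or the precrossings of a pseudolink diagram. An \emph{oriented singular link} is a class of diagrams modulo planar isotopy (on the sphere, where the position of disconnected parts of a diagram relative to each other is disregarded) and the oriented Reidemeister moves, in all orientations: the three classical moves; the moves that pass a strand over or under a flat crossing; and the move that passes a classical crossing of the two strands of a flat crossing, with which it bounds a bigon, from one side of the flat crossing to the other. \emph{Oriented pseudolinks} are defined in the same way, with the additional move that removes a kink whose crossing is flat. **The fundamental psyquandle.** Let $D$ be a diagram and $G$ its set of semiarcs (the edges of the 4-valent graph of $D$, together with the circles without crossings). Turn a crossing so that both strands point upwards, and let $a,b$ be its semiarcs at the bottom left and top left, $c,d$ those at the top right and bottom right. The crossing relations are $c=a\,\overline{\triangleright}\,b$, $d=b\,\underline{\triangleright}\,a$ at a positive crossing; $c=a\,\underline{\triangleright}\,b$, $d=b\,\overline{\triangleright}\,a$ at a negative crossing;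 $c=a\,\overline{\bullet}\,b$, $d=b\,\underline{\bullet}\,a$ at a flat crossing. Words in $G$ are built from the four operations, the inverses of the maps $x\mapsto x\ast y$ for the four operations $\ast$, the components of $S^{-1}$ and $S'^{-1}$, and binary operation symbols $w(x,y),z(x,y)$ for the solutions of the four equations above. The \emph{fundamental psyquandle} $\mathcal P(D)$ is the set of words modulo the congruence generated by the psyquandle axioms and the crossing relations of $D$. The \emph{fundamental pI-adequate psyquandle} $\mathcal P_I(D)$ is defined in the same way, with the relations $x\,\underline{\bullet}\,x\sim x\,\overline{\bullet}\,x$ added. **Theorem.** If two diagrams $D,D'$ represent the same oriented singular link, then $\mathcal P(D)$ and $\mathcal P(D')$ are isomorphic psyquandles. If two diagrams $D,D'$ represent the same oriented pseudolink, then $\mathcal P_I(D)$ and $\mathcal P_I(D')$ are isomorphic psyquandles. That is, the isomorphism class of $\mathcal P(D)$ is an invariant of oriented singular links, and the isomorphism class of $\mathcal P_I(D)$ is an invariant of oriented pseudolinks. -/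

import Mathlib

namespace Psy

/-! ## Psyquandles -/

/-- The four binary operations of a psyquandle: `triU` and `triO` are the classical (biquandle)
operations (underlined and overlined triangle), `bulU` and `bulO` are the operations at singular
crossings or precrossings (underlined and overlined bullet). -/
class PsyOps (X : Type*) where
  triU : X → X → X
  triO : X → X → X
  bulU : X → X → X
  bulO : X → X → X

infixl:70 " ▷ᵤ " => PsyOps.triU
infixl:70 " ▷ₒ " => PsyOps.triO
infixl:70 " •ᵤ " => PsyOps.bulU
infixl:70 " •ₒ " => PsyOps.bulO

/-- A psyquandle. The first eight fields say that `X` is a biquandle. -/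
class Psyquandle (X : Type*) extends PsyOps X where
  diag : ∀ x : X, x ▷ᵤ x = x ▷ₒ x
  over_bij : ∀ y : X, Function.Bijective (fun x : X => x ▷ₒ y)
  under_bij : ∀ y : X, Function.Bijective (fun x : X => x ▷ᵤ y)
  side_bij : Function.Bijective (fun p : X × X => (p.2 ▷ₒ p.1, p.1 ▷ᵤ p.2))
  exch_uu : ∀ x y z : X, (x ▷ᵤ y) ▷ᵤ (z ▷ᵤ y) = (x ▷ᵤ z) ▷ᵤ (y ▷ₒ z)
  exch_uo : ∀ x y z : X, (x ▷ᵤ y) ▷ₒ (z ▷ᵤ y) = (x ▷ₒ z) ▷ᵤ (y ▷ₒ z)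
  exch_oo : ∀ x y z : X, (x ▷ₒ y) ▷ₒ (z ▷ₒ y) = (x ▷ₒ z) ▷ₒ (y ▷ᵤ z)
  sover_bij : ∀ y : X, Function.Bijective (fun x : X => x •ₒ y)
  sunder_bij : ∀ y : X, Function.Bijective (fun x : X => x •ᵤ y)
  sside_bij : Function.Bijective (fun p : X × X => (p.2 •ₒ p.1, p.1 •ᵤ p.2))
  psii : ∀ x y : X, ∃! p : X × X,
    x ▷ᵤ y = p.2 •ₒ y ∧ y ▷ₒ x = p.1 •ₒ x ∧
    p.1 ▷ᵤ p.2 = y •ᵤ p.2 ∧ p.2 ▷ₒ p.1 = x •ᵤ p.1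
  mix₁ : ∀ x y z : X, (x ▷ₒ y) ▷ₒ (z •ₒ y) = (x ▷ₒ z) ▷ₒ (y •ᵤ z)
  mix₂ : ∀ x y z : X, (x ▷ᵤ y) ▷ᵤ (z •ₒ y) = (x ▷ᵤ z) ▷ᵤ (y •ᵤ z)
  mix₃ : ∀ x y z : X, (x ▷ₒ y) •ₒ (z ▷ₒ y) = (x •ₒ z) ▷ₒ (y ▷ᵤ z)
  mix₄ : ∀ x y z : X, (x ▷ᵤ y) •ᵤ (z ▷ᵤ y) = (x •ᵤ z) ▷ᵤ (y ▷ₒ z)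
  mix₅ : ∀ x y z : X, (x ▷ₒ y) •ᵤ (z ▷ₒ y) = (x •ᵤ z) ▷ₒ (y ▷ᵤ z)
  mix₆ : ∀ x y z : X, (x ▷ᵤ y) •ₒ (z ▷ᵤ y) = (x •ₒ z) ▷ᵤ (y ▷ₒ z)

/-- A psyquandle is pI-adequate if the two singular operations agree on the diagonal. -/
def IsPIAdequate (X : Type*) [Psyquandle X] : Prop := ∀ x : X, x •ᵤ x = x •ₒ x

/-- Isomorphisms of psyquandles: bijections that respect the four operations. -/
structure PsyIso (X Y : Type*) [Psyquandle X] [Psyquandle Y] extends X ≃ Y where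
  map_under : ∀ x y : X, toFun (x ▷ᵤ y) = toFun x ▷ᵤ toFun y
  map_over : ∀ x y : X, toFun (x ▷ₒ y) = toFun x ▷ₒ toFun y
  map_sunder : ∀ x y : X, toFun (x •ᵤ y) = toFun x •ᵤ toFun y
  map_sover : ∀ x y : X, toFun (x •ₒ y) = toFun x •ₒ toFun y

/-! ## Psyquandles given by generators and relations -/

/-- The symbols from which psyquandle words are built: the four operations, the inverses of the
maps `x ↦ x ▷ᵤ y`, `x ↦ x ▷ₒ y`, `x ↦ x •ᵤ y`, `x ↦ x •ₒ y`, the two components of the inverses of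
the maps `S` and `S'`, and the solutions `w` and `z` of the four equations of the axiom `psii`. -/
inductive Op where
  | triU | triO | bulU | bulO
  | triUInv | triOInv | bulUInv | bulOInv
  | sideInv₁ | sideInv₂ | ssideInv₁ | ssideInv₂
  | w | z

/-- Psyquandle words in the generators `G`. -/
inductive Word (G : Type*) where
  | gen : G → Word G
  | op : Op → Word G → Word G → Word G

instance {G : Type*} : PsyOps (Word G) where
  triU := Word.op Op.triU
  triO := Word.op Op.triO
  bulU := Word.op Op.bulU
  bulO := Word.op Op.bulO

open Word in
/-- The congruence on words generated by the defining relations `R` and by the psyquandle axioms,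
together with pI-adequacy if `pI` holds. -/
inductive WordRel {G : Type*} (R : Word G → Word G → Prop) (pI : Prop) : Word G → Word G → Prop
  | rel {x y} : R x y → WordRel R pI x y
  | refl (x) : WordRel R pI x x
  | symm {x y} : WordRel R pI x y → WordRel R pI y x
  | trans {x y z} : WordRel R pI x y → WordRel R pI y z → WordRel R pI x z
  | congr (o : Op) {x x' y y'} :
      WordRel R pI x x' → WordRel R pI y y' → WordRel R pI (op o x y) (op o x' y')
  | diag (x) : WordRel R pI (x ▷ᵤ x) (x ▷ₒ x)
  | over_inv (x y) : WordRel R pI (op .triOInv (x ▷ₒ y) y) x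
  | inv_over (x y) : WordRel R pI (op .triOInv x y ▷ₒ y) x
  | under_inv (x y) : WordRel R pI (op .triUInv (x ▷ᵤ y) y) x
  | inv_under (x y) : WordRel R pI (op .triUInv x y ▷ᵤ y) x
  | side_inv₁ (x y) : WordRel R pI (op .sideInv₁ (y ▷ₒ x) (x ▷ᵤ y)) x
  | side_inv₂ (x y) : WordRel R pI (op .sideInv₂ (y ▷ₒ x) (x ▷ᵤ y)) y
  | inv_side₁ (x y) : WordRel R pI (op .sideInv₂ x y ▷ₒ op .sideInv₁ x y) x
  | inv_side₂ (x y) : WordRel R pI (op .sideInv₁ x y ▷ᵤ op .sideInv₂ x y) y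
  | exch_uu (x y z) : WordRel R pI ((x ▷ᵤ y) ▷ᵤ (z ▷ᵤ y)) ((x ▷ᵤ z) ▷ᵤ (y ▷ₒ z))
  | exch_uo (x y z) : WordRel R pI ((x ▷ᵤ y) ▷ₒ (z ▷ᵤ y)) ((x ▷ₒ z) ▷ᵤ (y ▷ₒ z))
  | exch_oo (x y z) : WordRel R pI ((x ▷ₒ y) ▷ₒ (z ▷ₒ y)) ((x ▷ₒ z) ▷ₒ (y ▷ᵤ z))
  | sover_inv (x y) : WordRel R pI (op .bulOInv (x •ₒ y) y) x
  | inv_sover (x y) : WordRel R pI (op .bulOInv x y •ₒ y) x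
  | sunder_inv (x y) : WordRel R pI (op .bulUInv (x •ᵤ y) y) x
  | inv_sunder (x y) : WordRel R pI (op .bulUInv x y •ᵤ y) x
  | sside_inv₁ (x y) : WordRel R pI (op .ssideInv₁ (y •ₒ x) (x •ᵤ y)) x
  | sside_inv₂ (x y) : WordRel R pI (op .ssideInv₂ (y •ₒ x) (x •ᵤ y)) y
  | inv_sside₁ (x y) : WordRel R pI (op .ssideInv₂ x y •ₒ op .ssideInv₁ x y) x
  | inv_sside₂ (x y) : WordRel R pI (op .ssideInv₁ x y •ᵤ op .ssideInv₂ x y) y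
  | psii₁ (x y) : WordRel R pI (x ▷ᵤ y) (op .z x y •ₒ y)
  | psii₂ (x y) : WordRel R pI (y ▷ₒ x) (op .w x y •ₒ x)
  | psii₃ (x y) : WordRel R pI (op .w x y ▷ᵤ op .z x y) (y •ᵤ op .z x y)
  | psii₄ (x y) : WordRel R pI (op .z x y ▷ₒ op .w x y) (x •ᵤ op .w x y)
  | mix₁ (x y z) : WordRel R pI ((x ▷ₒ y) ▷ₒ (z •ₒ y)) ((x ▷ₒ z) ▷ₒ (y •ᵤ z))
  | mix₂ (x y z) : WordRel R pI ((x ▷ᵤ y) ▷ᵤ (z •ₒ y)) ((x ▷ᵤ z) ▷ᵤ (y •ᵤ z))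
  | mix₃ (x y z) : WordRel R pI ((x ▷ₒ y) •ₒ (z ▷ₒ y)) ((x •ₒ z) ▷ₒ (y ▷ᵤ z))
  | mix₄ (x y z) : WordRel R pI ((x ▷ᵤ y) •ᵤ (z ▷ᵤ y)) ((x •ᵤ z) ▷ᵤ (y ▷ₒ z))
  | mix₅ (x y z) : WordRel R pI ((x ▷ₒ y) •ᵤ (z ▷ₒ y)) ((x •ᵤ z) ▷ₒ (y ▷ᵤ z))
  | mix₆ (x y z) : WordRel R pI ((x ▷ᵤ y) •ₒ (z ▷ᵤ y)) ((x •ₒ z) ▷ᵤ (y ▷ₒ z))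
  | adequate (h : pI) (x) : WordRel R pI (x •ᵤ x) (x •ₒ x)

/-- The psyquandle (the pI-adequate psyquandle, if `pI` holds) presented by the generators `G` and
the relations `R`. -/
def Presented (G : Type*) (R : Word G → Word G → Prop) (pI : Prop) : Type _ :=
  Quot (WordRel R pI)

namespace Presented

variable {G : Type*} {R : Word G → Word G → Prop} {pI : Prop}

/-- The class of a word. -/
def mk (R : Word G → Word G → Prop) (pI : Prop) (x : Word G) : Presented G R pI := Quot.mk _ x

theorem sound {x y : Word G} (h : WordRel R pI x y) : mk R pI x = mk R pI y := Quot.sound h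

/-- The operation on classes of words that is induced by a symbol. -/
def op (o : Op) : Presented G R pI → Presented G R pI → Presented G R pI :=
  Quot.map₂ (Word.op o) (fun x _ _ h => .congr o (.refl x) h) (fun _ _ y h => .congr o h (.refl y))

instance : PsyOps (Presented G R pI) where
  triU := op .triU
  triO := op .triO
  bulU := op .bulU
  bulO := op .bulO

theorem exists_rep (x : Presented G R pI) : ∃ u, mk R pI u = x := Quot.exists_rep x

theorem forall₁ {p : Presented G R pI → Prop} (h : ∀ u, p (mk R pI u)) : ∀ x, p x := by
  intro x; obtain ⟨u, rfl⟩ := exists_rep x; exact h u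

theorem bij_of_inv {o o' : Op} (h₁ : ∀ x y : Word G, WordRel R pI (.op o' (.op o x y) y) x)
    (h₂ : ∀ x y : Word G, WordRel R pI (.op o (.op o' x y) y) x) (y : Presented G R pI) :
    Function.Bijective (fun x => op o x y) := by
  refine Function.bijective_iff_has_inverse.2 ⟨fun x => op o' x y, ?_, ?_⟩
  · intro x
    obtain ⟨u, rfl⟩ := exists_rep x
    obtain ⟨v, rfl⟩ := exists_rep y
    exact sound (h₁ u v)
  · intro x
    obtain ⟨u, rfl⟩ := exists_rep x
    obtain ⟨v, rfl⟩ := exists_rep y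
    exact sound (h₂ u v)

theorem side_bij_of_inv {o u i₁ i₂ : Op}
    (h₁ : ∀ x y : Word G, WordRel R pI (.op i₁ (.op o y x) (.op u x y)) x)
    (h₂ : ∀ x y : Word G, WordRel R pI (.op i₂ (.op o y x) (.op u x y)) y)
    (h₃ : ∀ x y : Word G, WordRel R pI (.op o (.op i₂ x y) (.op i₁ x y)) x)
    (h₄ : ∀ x y : Word G, WordRel R pI (.op u (.op i₁ x y) (.op i₂ x y)) y) :
    Function.Bijective (fun p : Presented G R pI × Presented G R pI =>
      (op o p.2 p.1, op u p.1 p.2)) := by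
  refine Function.bijective_iff_has_inverse.2 ⟨fun p => (op i₁ p.1 p.2, op i₂ p.1 p.2), ?_, ?_⟩
  · rintro ⟨x, y⟩
    obtain ⟨a, rfl⟩ := exists_rep x
    obtain ⟨b, rfl⟩ := exists_rep y
    exact Prod.ext (sound (h₁ a b)) (sound (h₂ a b))
  · rintro ⟨x, y⟩
    obtain ⟨a, rfl⟩ := exists_rep x
    obtain ⟨b, rfl⟩ := exists_rep y
    exact Prod.ext (sound (h₃ a b)) (sound (h₄ a b))

instance : Psyquandle (Presented G R pI) where
  diag := forall₁ fun a => sound (.diag a)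
  over_bij := bij_of_inv .over_inv .inv_over
  under_bij := bij_of_inv .under_inv .inv_under
  side_bij := side_bij_of_inv .side_inv₁ .side_inv₂ .inv_side₁ .inv_side₂
  exch_uu := forall₁ fun a => forall₁ fun b => forall₁ fun c => sound (.exch_uu a b c)
  exch_uo := forall₁ fun a => forall₁ fun b => forall₁ fun c => sound (.exch_uo a b c)
  exch_oo := forall₁ fun a => forall₁ fun b => forall₁ fun c => sound (.exch_oo a b c)
  sover_bij := bij_of_inv .sover_inv .inv_sover
  sunder_bij := bij_of_inv .sunder_inv .inv_sunder
  sside_bij := side_bij_of_inv .sside_inv₁ .sside_inv₂ .inv_sside₁ .inv_sside₂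
  psii := by
    refine forall₁ fun a => forall₁ fun b => ?_
    refine ⟨(mk R pI (.op .w a b), mk R pI (.op .z a b)),
      ⟨sound (.psii₁ a b), sound (.psii₂ a b), sound (.psii₃ a b), sound (.psii₄ a b)⟩, ?_⟩
    rintro ⟨w, z⟩ ⟨h₁, h₂, -, -⟩
    have inj := fun y : Presented G R pI =>
      (bij_of_inv (o := .bulO) (o' := .bulOInv) .sover_inv .inv_sover y).1
    exact Prod.ext (inj _ (h₂.symm.trans (sound (.psii₂ a b))))
      (inj _ (h₁.symm.trans (sound (.psii₁ a b))))
  mix₁ := forall₁ fun a => forall₁ fun b => forall₁ fun c => sound (.mix₁ a b c)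
  mix₂ := forall₁ fun a => forall₁ fun b => forall₁ fun c => sound (.mix₂ a b c)
  mix₃ := forall₁ fun a => forall₁ fun b => forall₁ fun c => sound (.mix₃ a b c)
  mix₄ := forall₁ fun a => forall₁ fun b => forall₁ fun c => sound (.mix₄ a b c)
  mix₅ := forall₁ fun a => forall₁ fun b => forall₁ fun c => sound (.mix₅ a b c)
  mix₆ := forall₁ fun a => forall₁ fun b => forall₁ fun c => sound (.mix₆ a b c)

theorem isPIAdequate (h : pI) : IsPIAdequate (Presented G R pI) :=
  forall₁ fun a => sound (.adequate h a)

end Presented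

/-! ## Oriented diagrams -/

/-- The kinds of crossings: positive, negative, and flat ones. A flat crossing is a singular
crossing of a singular link diagram, or a precrossing of a pseudolink diagram. -/
inductive Kind where
  | pos | neg | flat

/-- The two strands at a crossing. Turn the crossing so that both strands point upwards; then
`slash` runs from the bottom left to the top right and `back` from the bottom right to the top left.
The crossing is positive if `slash` is the over-strand, and negative if `back` is. -/
inductive Strand where
  | slash | back

/-- The data of an oriented diagram in a disc with `n` strands ending on the boundary (`n = 0`:
a closed diagram). `Arc` is the set of semiarcs, `Cr` is the set of crossings; `inc c s` and
`out c s` are the semiarcs by which the strand `s` enters and leaves the crossing `c`. `entry i`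
and `exit i` are the semiarcs that start, respectively end, at the marked points of the boundary.
Semiarcs that touch neither crossings nor the boundary are closed circles. -/
structure Tangle (n : ℕ) : Type 1 where
  Arc : Type
  Cr : Type
  kind : Cr → Kind
  inc : Cr → Strand → Arc
  out : Cr → Strand → Arc
  entry : Fin n → Arc
  exit : Fin n → Arc

namespace Tangle

/-- The places where a semiarc can start, with the semiarc that starts there. -/
def starts {n : ℕ} (T : Tangle n) : Fin n ⊕ T.Cr × Strand → T.Arc :=
  Sum.elim T.entry (fun p => T.out p.1 p.2)

/-- The places where a semiarc can end, with the semiarc that ends there. -/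
def ends {n : ℕ} (T : Tangle n) : Fin n ⊕ T.Cr × Strand → T.Arc :=
  Sum.elim T.exit (fun p => T.inc p.1 p.2)

/-- Every semiarc either has exactly one start and exactly one end, or is a closed circle. -/
def Proper {n : ℕ} (T : Tangle n) : Prop :=
  Function.Injective T.starts ∧ Function.Injective T.ends ∧ Set.range T.starts = Set.range T.ends

/-- Isomorphisms of diagrams, that is, relabellings of the semiarcs and the crossings. -/
structure Iso {n : ℕ} (T T' : Tangle n) where
  arc : T.Arc ≃ T'.Arc
  cr : T.Cr ≃ T'.Cr
  kind_eq : ∀ c, T'.kind (cr c) = T.kind c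
  inc_eq : ∀ c s, T'.inc (cr c) s = arc (T.inc c s)
  out_eq : ∀ c s, T'.out (cr c) s = arc (T.out c s)
  entry_eq : ∀ i, T'.entry i = arc (T.entry i)
  exit_eq : ∀ i, T'.exit i = arc (T.exit i)

/-- The four corners at a crossing whose strands point upwards. -/
inductive Corner where
  | left | right | bottom | top

/-- The corner to the left of the end by which a strand enters a crossing. -/
def leftOfInc : Strand → Corner
  | .slash => .left
  | .back => .bottom

/-- The corner to the right of the end by which a strand enters a crossing. -/
def rightOfInc : Strand → Corner
  | .slash => .bottom
  | .back => .right

/-- The corner to the left of the end by which a strand leaves a crossing. -/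
def leftOfOut : Strand → Corner
  | .slash => .top
  | .back => .left

/-- The corner to the right of the end by which a strand leaves a crossing. -/
def rightOfOut : Strand → Corner
  | .slash => .right
  | .back => .top

/-- Two corners that lie along the same side of a semiarc belong to the same face. -/
inductive FaceRel (T : Tangle 0) : T.Cr × Corner → T.Cr × Corner → Prop
  | left (c s d t) : T.out c s = T.inc d t → FaceRel T (c, leftOfOut s) (d, leftOfInc t)
  | right (c s d t) : T.out c s = T.inc d t → FaceRel T (c, rightOfOut s) (d, rightOfInc t)

/-- Two crossings that are joined by a semiarc belong to the same connected component. -/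
def Joined (T : Tangle 0) (c d : T.Cr) : Prop := ∃ s t, T.out c s = T.inc d t

/-- A closed diagram is planar if the surface that is obtained from the 4-valent graph of its
crossings by gluing a disc into each face is a union of spheres. As the graph has twice as many
edges as vertices, the Euler characteristic turns this into
`faces = crossings + 2 * connected components`. (Closed circles need no condition.) -/
def Planar (T : Tangle 0) : Prop :=
  Nat.card (Quot T.FaceRel) = Nat.card T.Cr + 2 * Nat.card (Quot T.Joined)

/-- The identifications of semiarcs when two diagrams in complementary discs are glued: what leaves
one of them enters the other. -/
inductive GlueRel {n : ℕ} (C T : Tangle n) : C.Arc ⊕ T.Arc → C.Arc ⊕ T.Arc → Prop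
  | into (i : Fin n) : GlueRel C T (.inl (C.exit i)) (.inr (T.entry i))
  | back (i : Fin n) : GlueRel C T (.inr (T.exit i)) (.inl (C.entry i))

/-- The closed diagram that is obtained by gluing `C` and `T` along their boundaries. -/
def glue {n : ℕ} (C T : Tangle n) : Tangle 0 where
  Arc := Quot (GlueRel C T)
  Cr := C.Cr ⊕ T.Cr
  kind := Sum.elim C.kind T.kind
  inc := Sum.elim (fun c s => Quot.mk _ (.inl (C.inc c s))) (fun c s => Quot.mk _ (.inr (T.inc c s)))
  out := Sum.elim (fun c s => Quot.mk _ (.inl (C.out c s))) (fun c s => Quot.mk _ (.inr (T.out c s)))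
  entry := Fin.elim0
  exit := Fin.elim0

end Tangle

/-! ## The local pictures of the Reidemeister moves -/

/-- What happens where the lines `a` and `b` cross. -/
inductive CrossType where
  | aOver | bOver | flat

/-- A crossing in a picture that consists of `n` numbered lines, each passing `m` times through
crossings. Each line has a reference direction. Turn the crossing so that the reference directions
of its two lines point upwards; then `a` is the line that runs from the bottom left to the top
right. The crossing is passage number `posA` of `a` and passage number `posB` of `b`, counted along
the reference directions. -/
structure LineCrossing (n m : ℕ) where
  a : Fin n
  b : Fin n
  posA : Fin m
  posB : Fin m
  type : CrossType

namespace LineCrossing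

variable {n m : ℕ}

/-- The line, with the number of the passage, that is the strand `s` of the crossing when the lines
are oriented by `fwd` (`true`: along the reference direction): reversing just one of two lines
interchanges `slash` and `back`. -/
def pass (c : LineCrossing n m) (fwd : Fin n → Bool) : Strand → Fin n × Fin m
  | .slash => if fwd c.a = fwd c.b then (c.a, c.posA) else (c.b, c.posB)
  | .back => if fwd c.a = fwd c.b then (c.b, c.posB) else (c.a, c.posA)

/-- The kind of the crossing when the lines are oriented by `fwd`. -/
def kind (c : LineCrossing n m) (fwd : Fin n → Bool) : Kind :=
  match c.type with
  | .aOver => if fwd c.a = fwd c.b then .pos else .neg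
  | .bOver => if fwd c.a = fwd c.b then .neg else .pos
  | .flat => .flat

end LineCrossing

/-- The picture with `n` lines, oriented by `fwd`, and the crossings `c`. Line `i` is cut by its `m`
passages into the semiarcs `(i, 0), …, (i, m)`, in the order of its reference direction. -/
def lineTangle {n m k : ℕ} (fwd : Fin n → Bool) (c : Fin k → LineCrossing n m) : Tangle n where
  Arc := Fin n × Fin (m + 1)
  Cr := Fin k
  kind j := (c j).kind fwd
  inc j s :=
    let p := (c j).pass fwd s
    (p.1, if fwd p.1 then p.2.castSucc else p.2.succ)
  out j s :=
    let p := (c j).pass fwd s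
    (p.1, if fwd p.1 then p.2.succ else p.2.castSucc)
  entry i := (i, if fwd i then 0 else Fin.last m)
  exit i := (i, if fwd i then Fin.last m else 0)

/-- Lines without crossings. -/
def uncrossed {n : ℕ} (fwd : Fin n → Bool) : Tangle n :=
  lineTangle (m := 0) fwd Fin.elim0

/-- One line with a kink. The two orientations of the line give the two kinks that are mirror
images of each other (without regard to the crossing). -/
def kink (fwd : Fin 1 → Bool) (t : CrossType) : Tangle 1 :=
  lineTangle (m := 2) fwd ![⟨0, 0, 0, 1, t⟩]

/-- Two lines whose reference directions point upwards; line `0` starts at the lower left, crosses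
line `1`, crosses it again and ends at the upper left. The types of the lower and of the upper
crossing are `t` and `t'`; the line `a` is line `0` at the lower and line `1` at the upper crossing. -/
def bigon (fwd : Fin 2 → Bool) (t t' : CrossType) : Tangle 2 :=
  lineTangle (m := 2) fwd ![⟨0, 1, 0, 0, t⟩, ⟨1, 0, 1, 1, t'⟩]

/-- The type of a crossing of two lines at the heights `h` and `h'`: the higher one is over, and at
the same height they cross flatly. -/
def heightType (h h' : Fin 3) : CrossType :=
  if h = h' then .flat else if h' < h then .aOver else .bOver

/-- Three lines that run upwards (in their reference directions), start in the order `0, 1, 2` from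
the left and end in the order `2, 1, 0`. From bottom to top, line `0` crosses line `1`, then
`0` crosses `2`, then `1` crosses `2`. -/
def triangle (fwd : Fin 3 → Bool) (h : Fin 3 → Fin 3) : Tangle 3 :=
  lineTangle (m := 2) fwd
    ![⟨0, 1, 0, 0, heightType (h 0) (h 1)⟩, ⟨0, 2, 1, 0, heightType (h 0) (h 2)⟩,
      ⟨1, 2, 1, 1, heightType (h 1) (h 2)⟩]

/-- The same three lines, on the other side of the triangle: from bottom to top, line `1` crosses
line `2`, then `0` crosses `2`, then `0` crosses `1`. -/
def triangle' (fwd : Fin 3 → Bool) (h : Fin 3 → Fin 3) : Tangle 3 :=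
  lineTangle (m := 2) fwd
    ![⟨0, 1, 1, 1, heightType (h 0) (h 1)⟩, ⟨0, 2, 0, 1, heightType (h 0) (h 2)⟩,
      ⟨1, 2, 0, 0, heightType (h 1) (h 2)⟩]

/-- The oriented Reidemeister moves, in all orientations. If `pseudo` holds, they include the first
move for a flat crossing (pseudolinks); otherwise they do not (singular links). -/
inductive LocalMove (pseudo : Prop) : (n : ℕ) → Tangle n → Tangle n → Prop
  /-- First move: a kink is removed. -/
  | one (fwd : Fin 1 → Bool) (t : CrossType) (ht : t = .flat → pseudo) :
      LocalMove pseudo 1 (kink fwd t) (uncrossed fwd)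
  /-- Second move, with line `0` above line `1`. -/
  | two_a (fwd : Fin 2 → Bool) : LocalMove pseudo 2 (bigon fwd .aOver .bOver) (uncrossed fwd)
  /-- Second move, with line `1` above line `0`. -/
  | two_b (fwd : Fin 2 → Bool) : LocalMove pseudo 2 (bigon fwd .bOver .aOver) (uncrossed fwd)
  /-- Third move: three lines at heights that are not all the same. Three different heights give the
  classical third move; if just two lines are at the same height, then the third line moves over
  or under their flat crossing. -/
  | three (fwd : Fin 3 → Bool) (h : Fin 3 → Fin 3) (hh : ∃ i j, h i ≠ h j) :
      LocalMove pseudo 3 (triangle fwd h) (triangle' fwd h)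
  /-- Flat second move: a half twist passes from one side of a flat crossing to the other. -/
  | flatTwist (fwd : Fin 2 → Bool) (t : CrossType) (ht : t ≠ .flat) :
      LocalMove pseudo 2 (bigon fwd t .flat) (bigon fwd .flat t)

/-! ## Oriented singular links and pseudolinks -/

/-- Oriented singular link diagrams or pseudolink diagrams: the flat crossings are the singular
crossings, respectively the precrossings. -/
structure Diagram : Type 1 extends Tangle 0 where
  finite_arc : Finite Arc
  finite_cr : Finite Cr
  proper : toTangle.Proper
  planar : toTangle.Planar

/-- Two diagrams are related if they are isomorphic, or if one arises from the other when a local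
picture in a disc is replaced according to a Reidemeister move. -/
inductive Diagram.Step (pseudo : Prop) : Diagram → Diagram → Prop
  | iso {D D' : Diagram} : Nonempty (D.toTangle.Iso D'.toTangle) → Diagram.Step pseudo D D'
  | move {D D' : Diagram} {n : ℕ} {T T' : Tangle n} (C : Tangle n) (hC : C.Proper) :
      LocalMove pseudo n T T' → Nonempty (D.toTangle.Iso (C.glue T)) →
      Nonempty (D'.toTangle.Iso (C.glue T')) → Diagram.Step pseudo D D'

/-- Oriented singular links: diagrams modulo the classical and the singular Reidemeister moves. -/
def SingularLink : Type 1 := Quot (Diagram.Step False)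

/-- Oriented pseudolinks: diagrams modulo the Reidemeister moves for pseudolinks. -/
def Pseudolink : Type 1 := Quot (Diagram.Step True)

/-- The oriented singular link represented by a diagram. -/
def Diagram.singularLink (D : Diagram) : SingularLink := Quot.mk _ D

/-- The oriented pseudolink represented by a diagram. -/
def Diagram.pseudolink (D : Diagram) : Pseudolink := Quot.mk _ D

/-! ## The fundamental psyquandle of a diagram -/

/-- The crossing relations. Turn a crossing so that its strands point upwards. If the two
semiarcs on its left carry `a` (bottom) and `b` (top), then the semiarc at the top right
carries `a ▷ₒ b`, `a ▷ᵤ b`, `a •ₒ b` at a positive, negative, flat crossing. -/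
def Kind.topRight {X : Type*} [PsyOps X] : Kind → X → X → X
  | .pos, a, b => a ▷ₒ b
  | .neg, a, b => a ▷ᵤ b
  | .flat, a, b => a •ₒ b

/-- In the same situation, the semiarc at the bottom right carries `b ▷ᵤ a`, `b ▷ₒ a`, `b •ᵤ a` at a
positive, negative, flat crossing. -/
def Kind.bottomRight {X : Type*} [PsyOps X] : Kind → X → X → X
  | .pos, a, b => b ▷ᵤ a
  | .neg, a, b => b ▷ₒ a
  | .flat, a, b => b •ᵤ a

open Word in
/-- The crossing relations of a diagram, as relations between words in its semiarcs. -/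
inductive Diagram.CrossingRel (D : Diagram) : Word D.Arc → Word D.Arc → Prop
  | topRight (c : D.Cr) : Diagram.CrossingRel D (gen (D.out c .slash))
      ((D.kind c).topRight (gen (D.inc c .slash)) (gen (D.out c .back)))
  | bottomRight (c : D.Cr) : Diagram.CrossingRel D (gen (D.inc c .back))
      ((D.kind c).bottomRight (gen (D.inc c .slash)) (gen (D.out c .back)))

/-- The fundamental psyquandle of a diagram. -/
abbrev Diagram.fundamentalPsyquandle (D : Diagram) : Type :=
  Presented D.Arc D.CrossingRel False

/-- The fundamental pI-adequate psyquandle of a diagram. -/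
abbrev Diagram.fundamentalPIPsyquandle (D : Diagram) : Type :=
  Presented D.Arc D.CrossingRel True

end Psy

/-! A fundamental psyquandle is generated by a universal coloring: a coloring of the semiarcs of `D`
in a presented psyquandle is the same as a substitution that respects the crossing relations. It
therefore suffices to compare colorings. Suppose that `D` and `D'` agree outside a disc, and that,
in every psyquandle (pI-adequate where required), each coloring of one diagram can be changed inside
the disc to a coloring of the other, the new colors being forced by those outside. Then the generic
coloring of `D` yields one of `D'` in the psyquandle of `D`, and conversely. These give maps in both
directions, and uniqueness of the extensions makes them mutually inverse
(`Diagram.nonempty_psyIso_of_extends`). Gluing (`Extends.glue`) reduces the hypothesis to the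
statement `SameColors` about the two local pictures of a move.

At a crossing, the colors of any two neighbouring semiarcs determine the other two. The second move
follows from this alone. A kink needs, besides idempotence on the diagonal, the converse that equal
right-hand colors force equal left-hand colors; for a flat kink this is where pI-adequacy enters.
The third moves amount to the exchange laws, pure and mixed; the eight orientations reduce to
triangles whose strands can all be drawn upwards and to cyclically oriented triangles. For parallel
strands, the twist at a flat crossing is literally the axiom `psii`; the antiparallel version has to
be derived from `psii` together with the mixed laws (`pos_flat_side`). Negative crossings are
reduced to positive ones by interchanging the two classical operations. -/

namespace Psy

/-! ## Colors at a crossing -/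

section Meets

variable {X : Type*}

/-- The crossing relations at a crossing of kind `k` whose semiarcs carry `a` (bottom left),
`b` (top left), `c` (top right) and `d` (bottom right). -/
def Meets [PsyOps X] (k : Kind) (a b c d : X) : Prop :=
  c = k.topRight a b ∧ d = k.bottomRight a b

/-- Reflecting a crossing in a horizontal line and then reversing both strands interchanges bottom
and top and changes the sign. -/
theorem meets_pos_iff_neg [PsyOps X] {a b c d : X} : Meets .pos a b c d ↔ Meets .neg b a d c :=
  and_comm

variable [Psyquandle X]

theorem Kind.topRight_bijective (k : Kind) (b : X) :
    Function.Bijective (fun a : X => k.topRight a b) := by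
  cases k
  exacts [Psyquandle.over_bij b, Psyquandle.under_bij b, Psyquandle.sover_bij b]

theorem Kind.bottomRight_bijective (k : Kind) (a : X) :
    Function.Bijective (fun b : X => k.bottomRight a b) := by
  cases k
  exacts [Psyquandle.under_bij a, Psyquandle.over_bij a, Psyquandle.sunder_bij a]

theorem Kind.right_bijective (k : Kind) :
    Function.Bijective (fun p : X × X => (k.topRight p.1 p.2, k.bottomRight p.1 p.2)) := by
  cases k
  · exact Psyquandle.side_bij.comp Prod.swap_bijective
  · exact Prod.swap_bijective.comp Psyquandle.side_bij
  · exact Psyquandle.sside_bij.comp Prod.swap_bijective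

namespace Meets

variable {k : Kind} {a a' b b' c c' d d' : X}

/-- The biquandle bijections, and their singular analogues, say that each of the four pairs of
neighbouring semiarcs can be colored freely and fixes the other pair. Opposite semiarcs have no such
property. -/
theorem bottom_left_unique (h : Meets k a b c d) (h' : Meets k a' b c d') : a = a' :=
  (k.topRight_bijective b).1 (h.1.symm.trans h'.1)

theorem top_left_unique (h : Meets k a b c d) (h' : Meets k a b' c' d) : b = b' :=
  (k.bottomRight_bijective a).1 (h.2.symm.trans h'.2)

theorem left_unique (h : Meets k a b c d) (h' : Meets k a' b' c d) : a = a' ∧ b = b' := by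
  have := k.right_bijective.1 (a₁ := (a, b)) (a₂ := (a', b'))
    (Prod.ext (h.1.symm.trans h'.1) (h.2.symm.trans h'.2))
  simpa using this

theorem right_unique (h : Meets k a b c d) (h' : Meets k a b c' d') : c = c' ∧ d = d' :=
  ⟨h.1.trans h'.1.symm, h.2.trans h'.2.symm⟩

theorem exists_right (k : Kind) (a b : X) : ∃ c d, Meets k a b c d := ⟨_, _, rfl, rfl⟩

theorem exists_top (k : Kind) (a d : X) : ∃ b c, Meets k a b c d := by
  obtain ⟨b, hb⟩ := (k.bottomRight_bijective a).2 d
  exact ⟨b, _, rfl, hb.symm⟩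

theorem exists_bottom (k : Kind) (b c : X) : ∃ a d, Meets k a b c d := by
  obtain ⟨a, ha⟩ := (k.topRight_bijective b).2 c
  exact ⟨a, _, ha.symm, rfl⟩

theorem exists_left (k : Kind) (c d : X) : ∃ a b, Meets k a b c d := by
  obtain ⟨⟨a, b⟩, h⟩ := k.right_bijective.2 (c, d)
  obtain ⟨h₁, h₂⟩ := Prod.mk.inj h
  exact ⟨a, b, h₁.symm, h₂.symm⟩

end Meets

/-! ### Exchanging the two classical operations -/

/-- The psyquandle with the same elements and the two classical operations interchanged. -/
def Mirror (X : Type*) : Type _ := X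

/-- The interchange permutes the axioms: `mix₁` with `mix₂`, `mix₃` with `mix₆`, `mix₄` with `mix₅`,
while `exch_uo` and `psii` are self-dual. A positive crossing in `Mirror X` is a negative one in
`X`, so that each statement about a positive crossing gives its negative counterpart. -/
instance : Psyquandle (Mirror X) where
  triU := PsyOps.triO (X := X)
  triO := PsyOps.triU (X := X)
  bulU := PsyOps.bulU (X := X)
  bulO := PsyOps.bulO (X := X)
  diag x := (Psyquandle.diag (X := X) x).symm
  over_bij := Psyquandle.under_bij (X := X)
  under_bij := Psyquandle.over_bij (X := X)
  side_bij := (Prod.swap_bijective.comp (Psyquandle.side_bij (X := X))).comp Prod.swap_bijective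
  exch_uu := Psyquandle.exch_oo (X := X)
  exch_uo x y z := (Psyquandle.exch_uo (X := X) x z y).symm
  exch_oo := Psyquandle.exch_uu (X := X)
  sover_bij := Psyquandle.sover_bij (X := X)
  sunder_bij := Psyquandle.sunder_bij (X := X)
  sside_bij := Psyquandle.sside_bij (X := X)
  psii x y := by
    obtain ⟨⟨w, z⟩, ⟨h₁, h₂, h₃, h₄⟩, h⟩ := Psyquandle.psii (X := X) y x
    refine ⟨(z, w), ⟨h₂, h₁, h₄, h₃⟩, ?_⟩
    rintro ⟨z', w'⟩ ⟨g₁, g₂, g₃, g₄⟩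
    have := h (w', z') ⟨g₂, g₁, g₄, g₃⟩
    exact congrArg Prod.swap this
  mix₁ := Psyquandle.mix₂ (X := X)
  mix₂ := Psyquandle.mix₁ (X := X)
  mix₃ := Psyquandle.mix₆ (X := X)
  mix₄ := Psyquandle.mix₅ (X := X)
  mix₅ := Psyquandle.mix₄ (X := X)
  mix₆ := Psyquandle.mix₃ (X := X)

/-! ### Kinks -/

open Psyquandle in
theorem eq_of_over_eq_under {a b : X} (h : a ▷ₒ b = b ▷ᵤ a) : a = b := by
  -- With `c` the common value in `h`, this reads `c ▷ₒ c = (a ▷ₒ a) ▷ₒ c`, so `c = a ▷ₒ a`. Hence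
  -- `(a, b)` and `(a, a)` have the same right-hand colors.
  have e₁ : (a ▷ₒ b) ▷ₒ (a ▷ₒ b) = (a ▷ₒ a) ▷ₒ (b ▷ᵤ a) := exch_oo a b a
  have e₂ : (b ▷ᵤ a) ▷ᵤ (b ▷ᵤ a) = (b ▷ᵤ b) ▷ᵤ (a ▷ₒ b) := exch_uu b a b
  rw [← h] at e₁ e₂
  have ha : a ▷ₒ b = a ▷ₒ a := (over_bij _).1 e₁
  have hb : a ▷ₒ b = b ▷ᵤ b := (under_bij _).1 e₂
  have : (a, b) = (a, a) := (Kind.right_bijective .pos).1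
    (Prod.ext ha (h.symm.trans (ha.trans (diag a).symm)))
  exact (Prod.mk.inj this).2.symm

open Psyquandle in
-- The law `mix₂` shows that `a` and `b` act alike through `▷ᵤ`. A suitable instance of `psii` then
-- has a solution with `w` equal to `x`, where two of its equations involve `x •ᵤ x` and `x •ₒ x`;
-- adequacy identifies these and leaves `a ▷ₒ x = b ▷ₒ x`.
theorem eq_of_sover_eq_sunder (hX : IsPIAdequate X) {a b : X} (h : a •ₒ b = b •ᵤ a) : a = b := by
  have hu (u : X) : u ▷ᵤ a = u ▷ᵤ b := by
    have := mix₂ u b a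
    rw [← h] at this
    exact ((under_bij _).1 this).symm
  -- This choice of `x` makes `a` the component `z` of the solution of `psii` at `(x, b)`.
  obtain ⟨x, hx⟩ := (under_bij b).2 (a •ₒ b)
  replace hx : x ▷ᵤ b = a •ₒ b := hx
  obtain ⟨⟨w, z⟩, ⟨h₁, h₂, h₃, h₄⟩, -⟩ := psii x b
  simp only at h₁ h₂ h₃ h₄
  obtain rfl : a = z := (sover_bij b).1 (hx.symm.trans h₁)
  obtain rfl : w = x := (under_bij b).1 ((hu w).symm.trans (h₃.trans (h.symm.trans hx.symm)))
  exact (over_bij w).1 (h₄.trans ((hX w).trans h₂.symm))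

theorem Kind.topRight_self {k : Kind} (hk : k = .flat → IsPIAdequate X) (a : X) :
    k.topRight a a = k.bottomRight a a := by
  cases k
  exacts [(Psyquandle.diag a).symm, Psyquandle.diag a, (hk rfl a).symm]

theorem Meets.left_eq {k : Kind} (hk : k = .flat → IsPIAdequate X) {a b c : X}
    (h : Meets k a b c c) : a = b := by
  obtain ⟨h₁, h₂⟩ := h
  have h := h₁.symm.trans h₂
  cases k
  exacts [eq_of_over_eq_under h, (eq_of_over_eq_under h.symm).symm,
    eq_of_sover_eq_sunder (hk rfl) h]

theorem Meets.right_eq {k : Kind} (hk : k = .flat → IsPIAdequate X) {a c d : X}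
    (h : Meets k a a c d) : c = d :=
  h.1.trans ((Kind.topRight_self hk a).trans h.2.symm)

/-! ### Twists at a flat crossing -/

open Psyquandle in
/-- A positive half twist of two parallel strands passes through a flat crossing. -/
theorem exists_pos_flat_iff {x₀ x₂ y₀ y₂ : X} :
    (∃ x y, Meets .pos x₀ y x y₀ ∧ Meets .flat y x₂ y₂ x) ↔
      ∃ x y, Meets .flat x₀ y x y₀ ∧ Meets .pos y x₂ y₂ x := by
  constructor
  · rintro ⟨x, w, ⟨rfl, rfl⟩, rfl, h⟩
    replace h : x₀ ▷ₒ w = x₂ •ᵤ w := h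
    -- The new middle left color is forced by the upper crossing. In `psii` at `(x₂, y)`, the
    -- solution consists of the old middle left color `w` and the bottom left color `x₀`, and its
    -- four equations are exactly the matching conditions of the two pictures.
    obtain ⟨y, hy⟩ := (over_bij x₂).2 (w •ₒ x₂)
    replace hy : y ▷ₒ x₂ = w •ₒ x₂ := hy
    obtain ⟨⟨w', z⟩, ⟨h₁, h₂, h₃, h₄⟩, -⟩ := psii x₂ y
    simp only at h₁ h₂ h₃ h₄
    obtain rfl : w' = w := (sover_bij x₂).1 (h₂.symm.trans hy)
    obtain rfl : z = x₀ := (over_bij w').1 (h₄.trans h.symm)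
    exact ⟨_, y, ⟨rfl, h₃⟩, hy.symm, h₁.symm⟩
  · rintro ⟨x, y, ⟨rfl, rfl⟩, rfl, h⟩
    obtain ⟨⟨w, z⟩, ⟨h₁, h₂, h₃, h₄⟩, -⟩ := psii x₂ y
    simp only at h₁ h₂ h₃ h₄
    obtain rfl : z = x₀ := (sover_bij y).1 (h₁.symm.trans h.symm)
    exact ⟨_, w, ⟨rfl, h₃.symm⟩, h₂, h₄⟩

theorem exists_classical_flat_iff {k : Kind} (hk : k ≠ .flat) {x₀ x₂ y₀ y₂ : X} :
    (∃ x y, Meets k x₀ y x y₀ ∧ Meets .flat y x₂ y₂ x) ↔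
      ∃ x y, Meets .flat x₀ y x y₀ ∧ Meets k y x₂ y₂ x := by
  cases k
  · exact exists_pos_flat_iff
  · exact exists_pos_flat_iff (X := Mirror X)
  · exact absurd rfl hk

open Psyquandle in
-- This is the antiparallel twist in equations: two crossings that share their right-hand colors are
-- traded for two others that again share theirs. The axiom `psii` supplies auxiliary colors `y` and
-- `z`, through which both sides can be compared by the exchange laws.
theorem pos_flat_side {p q p' q' : X} (ho : p •ₒ q = p' ▷ₒ q') (hu : q •ᵤ p = q' ▷ᵤ p') :
    q' •ₒ p' = q ▷ₒ p ∧ p' •ᵤ q' = p ▷ᵤ q := by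
  -- Chosen so that `psii` at `(q, y)` has `w = p`.
  obtain ⟨y, hy⟩ := (over_bij q).2 (p •ₒ q)
  replace hy : y ▷ₒ q = p •ₒ q := hy
  obtain ⟨⟨w, z⟩, ⟨h₁, h₂, h₃, h₄⟩, -⟩ := psii q y
  simp only at h₁ h₂ h₃ h₄
  obtain rfl : w = p := (sover_bij q).1 (h₂.symm.trans hy)
  have hs : z ▷ₒ w = q' ▷ᵤ p' := h₄.trans hu
  have hY : y ▷ₒ w = p' ▷ₒ p' := by
    refine (over_bij (q •ᵤ w)).1 ?_
    calc (y ▷ₒ w) ▷ₒ (q •ᵤ w) = (y ▷ₒ q) ▷ₒ (w •ₒ q) := (mix₁ y q w).symm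
      _ = (p' ▷ₒ q') ▷ₒ (p' ▷ₒ q') := by rw [hy, ho]
      _ = (p' ▷ₒ p') ▷ₒ (q' ▷ᵤ p') := exch_oo p' q' p'
      _ = (p' ▷ₒ p') ▷ₒ (q •ᵤ w) := by rw [hu]
  -- Both claims are proved after acting on the right by a bijection: `e₁` and `e₂` compute one
  -- side, `mix₆` and `mix₄` the other. The substitutions `hY` and `hs` bring in `y` and `z`, for
  -- which the equations of `psii` are available.
  have e₁ : (q' ▷ᵤ p') •ₒ (p' ▷ᵤ p') = (q ▷ₒ w) ▷ᵤ (p' ▷ₒ p') := by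
    rw [diag, ← hY, ← hs, mix₃, ← h₁, exch_uo]
  have e₂ : (p' ▷ᵤ p') •ᵤ (q' ▷ᵤ p') = (w ▷ᵤ q) ▷ᵤ (p' ▷ₒ q') := by
    rw [diag, ← hY, ← hs, mix₅, ← h₃, exch_uo, ← ho, mix₂, hs, ← hu, diag]
  constructor
  · exact (under_bij (p' ▷ₒ p')).1 ((mix₆ q' p' p').symm.trans e₁)
  · exact (under_bij (p' ▷ₒ q')).1 ((mix₄ p' p' q').symm.trans e₂)

/-- A half twist of two antiparallel strands passes through a flat crossing. -/
theorem Meets.flat_side {k : Kind} (hk : k ≠ .flat) {p q p' q' c d : X}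
    (h : Meets .flat p q c d) (h' : Meets k p' q' c d) :
    ∃ c' d', Meets .flat q' p' c' d' ∧ Meets k q p c' d' := by
  have ho := h.1.symm.trans h'.1
  have hu := h.2.symm.trans h'.2
  refine ⟨_, _, ⟨rfl, rfl⟩, ?_⟩
  cases k
  · exact pos_flat_side ho hu
  · exact pos_flat_side (X := Mirror X) ho hu
  · exact absurd rfl hk

end Meets

/-! ## Colors at a triangle -/

section Triangle

variable {X : Type*} [Psyquandle X]

/-- The kind of a crossing at which `slash` has height `p` and `back` has height `q`. -/
def kindOfHeights (p q : Fin 3) : Kind :=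
  if p = q then .flat else if q < p then .pos else .neg

open Psyquandle in
/-- The exchange laws for three parallel strands at the heights `p`, `q`, `r`. -/
theorem exchange_parallel {p q r : Fin 3} (h : ¬(p = q ∧ q = r)) (x y z : X) :
    let k₁ := kindOfHeights p q
    let k₂ := kindOfHeights p r
    let k₃ := kindOfHeights q r
    k₂.topRight (k₁.topRight x y) (k₃.bottomRight y z)
        = k₁.topRight (k₂.topRight x z) (k₃.topRight y z) ∧
      k₃.topRight (k₁.bottomRight x y) (k₂.bottomRight x z)
        = k₁.bottomRight (k₂.topRight x z) (k₃.topRight y z) ∧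
      k₂.bottomRight (k₁.topRight x y) (k₃.bottomRight y z)
        = k₃.bottomRight (k₁.bottomRight x y) (k₂.bottomRight x z) := by
  -- Only the order type of the heights matters. The inconsistent cases and the case of three equal
  -- heights are discarded; in the others each identity is a single exchange law.
  rcases lt_trichotomy p q with h₁ | h₁ | h₁ <;> rcases lt_trichotomy q r with h₂ | h₂ | h₂ <;>
    rcases lt_trichotomy p r with h₃ | h₃ | h₃ <;> first | (exfalso; omega) | skip
  all_goals
    simp only [kindOfHeights, h₁, h₂, h₃, if_true, if_false, ne_of_lt, ne_of_gt, not_lt_of_gt,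
      Kind.topRight, Kind.bottomRight]
    refine ⟨?_, ?_, ?_⟩ <;> first
      | exact exch_uu _ _ _ | exact exch_uo _ _ _ | exact exch_oo _ _ _
      | exact (exch_uu _ _ _).symm | exact (exch_uo _ _ _).symm | exact (exch_oo _ _ _).symm
      | exact mix₁ _ _ _ | exact mix₂ _ _ _ | exact mix₃ _ _ _
      | exact mix₄ _ _ _ | exact mix₅ _ _ _ | exact mix₆ _ _ _
      | exact (mix₁ _ _ _).symm | exact (mix₂ _ _ _).symm | exact (mix₃ _ _ _).symm
      | exact (mix₄ _ _ _).symm | exact (mix₅ _ _ _).symm | exact (mix₆ _ _ _).symm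

open Psyquandle in
/-- The exchange laws for three strands at the heights `p`, `q`, `r` around a cyclically oriented
triangle. -/
theorem exchange_cyclic {p q r : Fin 3} (h : ¬(p = q ∧ q = r)) (x y z : X) :
    let k₁ := kindOfHeights q p
    let k₂ := kindOfHeights p r
    let k₃ := kindOfHeights r q
    k₂.topRight (k₁.bottomRight y x) (k₃.topRight z y)
        = k₁.bottomRight (k₃.bottomRight z y) (k₂.topRight x z) ∧
      k₁.topRight (k₃.bottomRight z y) (k₂.topRight x z)
        = k₃.bottomRight (k₂.bottomRight x z) (k₁.topRight y x) ∧
      k₃.topRight (k₂.bottomRight x z) (k₁.topRight y x)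
        = k₂.bottomRight (k₁.bottomRight y x) (k₃.topRight z y) := by
  rcases lt_trichotomy p q with h₁ | h₁ | h₁ <;> rcases lt_trichotomy q r with h₂ | h₂ | h₂ <;>
    rcases lt_trichotomy p r with h₃ | h₃ | h₃ <;> first | (exfalso; omega) | skip
  all_goals
    simp only [kindOfHeights, h₁, h₂, h₃, if_true, if_false, ne_of_lt, ne_of_gt, not_lt_of_gt,
      Kind.topRight, Kind.bottomRight]
    refine ⟨?_, ?_, ?_⟩ <;> first
      | exact exch_uu _ _ _ | exact exch_uo _ _ _ | exact exch_oo _ _ _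
      | exact (exch_uu _ _ _).symm | exact (exch_uo _ _ _).symm | exact (exch_oo _ _ _).symm
      | exact mix₁ _ _ _ | exact mix₂ _ _ _ | exact mix₃ _ _ _
      | exact mix₄ _ _ _ | exact mix₅ _ _ _ | exact mix₆ _ _ _
      | exact (mix₁ _ _ _).symm | exact (mix₂ _ _ _).symm | exact (mix₃ _ _ _).symm
      | exact (mix₄ _ _ _).symm | exact (mix₅ _ _ _).symm

/-- Three strands run upwards and start in the order `x`, `y`, `z` from the left. The strand `x`
crosses `y` and then `z`, before `y` crosses `z`. -/
def LowerTriangle (p q r : Fin 3) (x₀ x₁ x₂ y₀ y₁ y₂ z₀ z₁ z₂ : X) : Prop :=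
  Meets (kindOfHeights p q) x₀ y₁ x₁ y₀ ∧ Meets (kindOfHeights p r) x₁ z₁ x₂ z₀ ∧
    Meets (kindOfHeights q r) y₁ z₂ y₂ z₁

/-- The same three strands, on the other side of the triangle. -/
def UpperTriangle (p q r : Fin 3) (x₀ x₁ x₂ y₀ y₁ y₂ z₀ z₁ z₂ : X) : Prop :=
  Meets (kindOfHeights p q) x₁ y₂ x₂ y₁ ∧ Meets (kindOfHeights p r) x₀ z₂ x₁ z₁ ∧
    Meets (kindOfHeights q r) y₀ z₁ y₁ z₀

/-- Three strands around a triangle that lies to the left of each of its crossings. -/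
def InnerTriangle (p q r : Fin 3) (x₀ x₁ x₂ y₀ y₁ y₂ z₀ z₁ z₂ : X) : Prop :=
  Meets (kindOfHeights q p) y₁ x₁ y₀ x₀ ∧ Meets (kindOfHeights p r) x₁ z₁ x₂ z₀ ∧
    Meets (kindOfHeights r q) z₁ y₁ z₂ y₂

/-- The same three strands, when the triangle lies to the right of each of its crossings. -/
def OuterTriangle (p q r : Fin 3) (x₀ x₁ x₂ y₀ y₁ y₂ z₀ z₁ z₂ : X) : Prop :=
  Meets (kindOfHeights q p) y₂ x₂ y₁ x₁ ∧ Meets (kindOfHeights p r) x₀ z₂ x₁ z₁ ∧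
    Meets (kindOfHeights r q) z₀ y₀ z₁ y₁

variable {p q r : Fin 3} {x₀ x₁ x₂ y₀ y₁ y₂ z₀ z₁ z₂ x₁' y₁' z₁' : X}

theorem LowerTriangle.unique (h : LowerTriangle p q r x₀ x₁ x₂ y₀ y₁ y₂ z₀ z₁ z₂)
    (h' : LowerTriangle p q r x₀ x₁' x₂ y₀ y₁' y₂ z₀ z₁' z₂) :
    x₁ = x₁' ∧ y₁ = y₁' ∧ z₁ = z₁' := by
  obtain ⟨h₁, h₂, h₃⟩ := h
  obtain ⟨h₁', h₂', h₃'⟩ := h'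
  obtain rfl := h₁.top_left_unique h₁'
  exact ⟨(h₁.right_unique h₁').1, rfl, (h₃.right_unique h₃').2⟩

theorem UpperTriangle.unique (h : UpperTriangle p q r x₀ x₁ x₂ y₀ y₁ y₂ z₀ z₁ z₂)
    (h' : UpperTriangle p q r x₀ x₁' x₂ y₀ y₁' y₂ z₀ z₁' z₂) :
    x₁ = x₁' ∧ y₁ = y₁' ∧ z₁ = z₁' := by
  obtain ⟨h₁, h₂, h₃⟩ := h
  obtain ⟨h₁', h₂', h₃'⟩ := h'
  obtain ⟨rfl, rfl⟩ := h₂.right_unique h₂'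
  exact ⟨rfl, (h₁.right_unique h₁').2, rfl⟩

theorem InnerTriangle.unique (h : InnerTriangle p q r x₀ x₁ x₂ y₀ y₁ y₂ z₀ z₁ z₂)
    (h' : InnerTriangle p q r x₀ x₁' x₂ y₀ y₁' y₂ z₀ z₁' z₂) :
    x₁ = x₁' ∧ y₁ = y₁' ∧ z₁ = z₁' := by
  obtain ⟨h₁, h₂, h₃⟩ := h
  obtain ⟨h₁', h₂', h₃'⟩ := h'
  obtain ⟨rfl, rfl⟩ := h₁.left_unique h₁'
  exact ⟨rfl, rfl, h₂.top_left_unique h₂'⟩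

theorem OuterTriangle.unique (h : OuterTriangle p q r x₀ x₁ x₂ y₀ y₁ y₂ z₀ z₁ z₂)
    (h' : OuterTriangle p q r x₀ x₁' x₂ y₀ y₁' y₂ z₀ z₁' z₂) :
    x₁ = x₁' ∧ y₁ = y₁' ∧ z₁ = z₁' := by
  obtain ⟨h₁, h₂, h₃⟩ := h
  obtain ⟨h₁', h₂', h₃'⟩ := h'
  exact ⟨(h₁.right_unique h₁').2, (h₁.right_unique h₁').1, (h₂.right_unique h₂').2⟩

theorem LowerTriangle.exists_upper (hh : ¬(p = q ∧ q = r))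
    (h : LowerTriangle p q r x₀ x₁ x₂ y₀ y₁ y₂ z₀ z₁ z₂) :
    ∃ x y z, UpperTriangle p q r x₀ x x₂ y₀ y y₂ z₀ z z₂ := by
  obtain ⟨⟨rfl, rfl⟩, ⟨rfl, rfl⟩, rfl, rfl⟩ := h
  -- These three semiarcs border the region on the far left; their colors are free and determine the
  -- whole picture.
  obtain ⟨e₁, e₂, e₃⟩ := exchange_parallel hh x₀ y₁ z₂
  exact ⟨_, _, _, ⟨e₁, rfl⟩, ⟨rfl, rfl⟩, e₂.symm, e₃⟩

/-- No converse of the exchange laws is needed. The colors `x₀`, `y₀`, `z₂` can be prescribed in the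
lower picture, and they determine everything in the upper one. Carrying the lower picture so
obtained across the triangle must thus give back the upper one, with the same ends. -/
theorem UpperTriangle.exists_lower (hh : ¬(p = q ∧ q = r))
    (h : UpperTriangle p q r x₀ x₁ x₂ y₀ y₁ y₂ z₀ z₁ z₂) :
    ∃ x y z, LowerTriangle p q r x₀ x x₂ y₀ y y₂ z₀ z z₂ := by
  obtain ⟨h₁, h₂, h₃⟩ := h
  obtain ⟨y, x, g₁⟩ := Meets.exists_top (kindOfHeights p q) x₀ y₀
  obtain ⟨y₂', z, g₃⟩ := Meets.exists_right (kindOfHeights q r) y z₂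
  obtain ⟨x₂', z₀', g₂⟩ := Meets.exists_right (kindOfHeights p r) x z
  obtain ⟨x', y', z', u₁, u₂, u₃⟩ := LowerTriangle.exists_upper hh ⟨g₁, g₂, g₃⟩
  obtain ⟨rfl, rfl⟩ := h₂.right_unique u₂
  obtain ⟨rfl, rfl⟩ := h₃.right_unique u₃
  obtain rfl := h₁.top_left_unique u₁
  obtain ⟨rfl, -⟩ := h₁.right_unique u₁
  exact ⟨x, y, z, g₁, g₂, g₃⟩

theorem InnerTriangle.exists_outer (hh : ¬(p = q ∧ q = r))
    (h : InnerTriangle p q r x₀ x₁ x₂ y₀ y₁ y₂ z₀ z₁ z₂) :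
    ∃ x y z, OuterTriangle p q r x₀ x x₂ y₀ y y₂ z₀ z z₂ := by
  obtain ⟨⟨rfl, rfl⟩, ⟨rfl, rfl⟩, rfl, rfl⟩ := h
  -- The sides of the triangle are the left-hand semiarcs of all three crossings, so their colors
  -- are free parameters.
  obtain ⟨e₁, e₂, e₃⟩ := exchange_cyclic hh x₁ y₁ z₁
  exact ⟨_, _, _, ⟨rfl, rfl⟩, ⟨e₁.symm, e₃⟩, rfl, e₂⟩

/-- Same argument as for `UpperTriangle.exists_lower`, with `x₀`, `y₀`, `z₀` as the determining
colors. -/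
theorem OuterTriangle.exists_inner (hh : ¬(p = q ∧ q = r))
    (h : OuterTriangle p q r x₀ x₁ x₂ y₀ y₁ y₂ z₀ z₁ z₂) :
    ∃ x y z, InnerTriangle p q r x₀ x x₂ y₀ y y₂ z₀ z z₂ := by
  obtain ⟨h₁, h₂, h₃⟩ := h
  obtain ⟨y, x, g₁⟩ := Meets.exists_left (kindOfHeights q p) y₀ x₀
  obtain ⟨z, x₂', g₂⟩ := Meets.exists_top (kindOfHeights p r) x z₀
  obtain ⟨z₂', y₂', g₃⟩ := Meets.exists_right (kindOfHeights r q) z y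
  obtain ⟨x', y', z', u₁, u₂, u₃⟩ := InnerTriangle.exists_outer hh ⟨g₁, g₂, g₃⟩
  obtain ⟨rfl, rfl⟩ := h₃.right_unique u₃
  obtain rfl := h₂.top_left_unique u₂
  obtain ⟨rfl, -⟩ := h₂.right_unique u₂
  obtain ⟨rfl, rfl⟩ := h₁.left_unique u₁
  exact ⟨x, y, z, g₁, g₂, g₃⟩

end Triangle

/-! ## Homomorphisms from a presented psyquandle -/

namespace Presented

variable {G G' : Type*} {R : Word G → Word G → Prop} {R' : Word G' → Word G' → Prop} {pI : Prop}

/-- The element of a presented psyquandle that arises from a word by substitution. -/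
def eval (σ : G → Presented G' R' pI) : Word G → Presented G' R' pI
  | .gen g => σ g
  | .op o x y => op o (eval σ x) (eval σ y)

/-- The target is itself a presented psyquandle, so all twelve word symbols, including the inverses
and the solutions of `psii`, act on it and satisfy their defining relations. -/
theorem eval_eq_of_wordRel {σ : G → Presented G' R' pI}
    (hσ : ∀ x y, R x y → eval σ x = eval σ y) {x y : Word G} (h : WordRel R pI x y) :
    eval σ x = eval σ y := by
  -- The relations for the inverse symbols and for `w`, `z` are not fields of `Psyquandle`; in the
  -- target they are read off from `WordRel` on representatives.
  have rep (x : Word G) : ∃ u, eval σ x = mk R' pI u := (exists_rep _).imp fun _ h => h.symm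
  induction h with
  | rel h => exact hσ _ _ h
  | refl x => rfl
  | symm _ h => exact h.symm
  | trans _ _ h h' => exact h.trans h'
  | congr o _ _ h h' => exact congrArg₂ (op o) h h'
  | diag x => exact Psyquandle.diag _
  | exch_uu x y z => exact Psyquandle.exch_uu _ _ _
  | exch_uo x y z => exact Psyquandle.exch_uo _ _ _
  | exch_oo x y z => exact Psyquandle.exch_oo _ _ _
  | mix₁ x y z => exact Psyquandle.mix₁ _ _ _
  | mix₂ x y z => exact Psyquandle.mix₂ _ _ _
  | mix₃ x y z => exact Psyquandle.mix₃ _ _ _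
  | mix₄ x y z => exact Psyquandle.mix₄ _ _ _
  | mix₅ x y z => exact Psyquandle.mix₅ _ _ _
  | mix₆ x y z => exact Psyquandle.mix₆ _ _ _
  | adequate h x => exact isPIAdequate h _
  | over_inv x y | inv_over x y | under_inv x y | inv_under x y
  | side_inv₁ x y | side_inv₂ x y | inv_side₁ x y | inv_side₂ x y
  | sover_inv x y | inv_sover x y | sunder_inv x y | inv_sunder x y
  | sside_inv₁ x y | sside_inv₂ x y | inv_sside₁ x y | inv_sside₂ x y
  | psii₁ x y | psii₂ x y | psii₃ x y | psii₄ x y =>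
    obtain ⟨u, hu⟩ := rep x
    obtain ⟨v, hv⟩ := rep y
    simp only [eval, PsyOps.triU, PsyOps.triO, PsyOps.bulU, PsyOps.bulO, hu, hv]
    apply sound
    first
      | exact .over_inv _ _ | exact .inv_over _ _ | exact .under_inv _ _ | exact .inv_under _ _
      | exact .side_inv₁ _ _ | exact .side_inv₂ _ _ | exact .inv_side₁ _ _ | exact .inv_side₂ _ _
      | exact .sover_inv _ _ | exact .inv_sover _ _ | exact .sunder_inv _ _ | exact .inv_sunder _ _
      | exact .sside_inv₁ _ _ | exact .sside_inv₂ _ _ | exact .inv_sside₁ _ _ | exact .inv_sside₂ _ _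
      | exact .psii₁ _ _ | exact .psii₂ _ _ | exact .psii₃ _ _ | exact .psii₄ _ _

/-- The map of presented psyquandles that is induced by a substitution. -/
def lift (σ : G → Presented G' R' pI) (hσ : ∀ x y, R x y → eval σ x = eval σ y) :
    Presented G R pI → Presented G' R' pI :=
  Quot.lift (eval σ) fun _ _ h => eval_eq_of_wordRel hσ h

theorem lift_op (σ : G → Presented G' R' pI) (hσ : ∀ x y, R x y → eval σ x = eval σ y) (o : Op)
    (x y : Presented G R pI) : lift σ hσ (op o x y) = op o (lift σ hσ x) (lift σ hσ y) := by
  obtain ⟨u, rfl⟩ := exists_rep x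
  obtain ⟨v, rfl⟩ := exists_rep y
  rfl

theorem eq_self_of_map_op {φ : Presented G R pI → Presented G R pI}
    (hφ : ∀ o x y, φ (op o x y) = op o (φ x) (φ y))
    (h : ∀ g, φ (mk R pI (.gen g)) = mk R pI (.gen g)) (x : Presented G R pI) : φ x = x := by
  obtain ⟨u, rfl⟩ := exists_rep x
  induction u with
  | gen g => exact h g
  | op o u v hu hv => exact (hφ o (mk R pI u) (mk R pI v)).trans (congrArg₂ (op o) hu hv)

/-- Two substitutions that are inverse to each other induce an isomorphism. -/
theorem nonempty_psyIso (σ : G → Presented G' R' pI) (hσ : ∀ x y, R x y → eval σ x = eval σ y)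
    (τ : G' → Presented G R pI) (hτ : ∀ x y, R' x y → eval τ x = eval τ y)
    (hτσ : ∀ g, lift τ hτ (σ g) = mk R pI (.gen g))
    (hστ : ∀ g, lift σ hσ (τ g) = mk R' pI (.gen g)) :
    Nonempty (PsyIso (Presented G R pI) (Presented G' R' pI)) :=
  ⟨{ toFun := lift σ hσ
     invFun := lift τ hτ
     left_inv := eq_self_of_map_op (fun o x y => by rw [lift_op, lift_op]) hτσ
     right_inv := eq_self_of_map_op (φ := fun x => lift σ hσ (lift τ hτ x))
      (fun o x y => by rw [lift_op, lift_op]) hστ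
     map_under := lift_op σ hσ .triU
     map_over := lift_op σ hσ .triO
     map_sunder := lift_op σ hσ .bulU
     map_sover := lift_op σ hσ .bulO }⟩

end Presented

/-! ### Isomorphism is an equivalence relation -/

namespace PsyIso

variable {X Y Z : Type*} [Psyquandle X] [Psyquandle Y] [Psyquandle Z]

/-- The identity. -/
def refl (X : Type*) [Psyquandle X] : PsyIso X X where
  toEquiv := Equiv.refl X
  map_under _ _ := rfl
  map_over _ _ := rfl
  map_sunder _ _ := rfl
  map_sover _ _ := rfl

/-- The inverse of an isomorphism. -/
def symm (e : PsyIso X Y) : PsyIso Y X where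
  toEquiv := e.toEquiv.symm
  map_under x y := e.toEquiv.symm_apply_eq.2 <| by
    simpa using (e.map_under (e.toEquiv.symm x) (e.toEquiv.symm y)).symm
  map_over x y := e.toEquiv.symm_apply_eq.2 <| by
    simpa using (e.map_over (e.toEquiv.symm x) (e.toEquiv.symm y)).symm
  map_sunder x y := e.toEquiv.symm_apply_eq.2 <| by
    simpa using (e.map_sunder (e.toEquiv.symm x) (e.toEquiv.symm y)).symm
  map_sover x y := e.toEquiv.symm_apply_eq.2 <| by
    simpa using (e.map_sover (e.toEquiv.symm x) (e.toEquiv.symm y)).symm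

/-- The composition of two isomorphisms. -/
def trans (e : PsyIso X Y) (e' : PsyIso Y Z) : PsyIso X Z where
  toEquiv := e.toEquiv.trans e'.toEquiv
  map_under x y := (congrArg e'.toFun (e.map_under x y)).trans (e'.map_under _ _)
  map_over x y := (congrArg e'.toFun (e.map_over x y)).trans (e'.map_over _ _)
  map_sunder x y := (congrArg e'.toFun (e.map_sunder x y)).trans (e'.map_sunder _ _)
  map_sover x y := (congrArg e'.toFun (e.map_sover x y)).trans (e'.map_sover _ _)

end PsyIso

/-! ## Colorings -/

namespace Tangle

/-- A coloring of the semiarcs that satisfies the crossing relations. -/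
def IsColoring {n : ℕ} (T : Tangle n) {X : Type*} [PsyOps X] (f : T.Arc → X) : Prop :=
  ∀ c, Meets (T.kind c) (f (T.inc c .slash)) (f (T.out c .back)) (f (T.out c .slash))
    (f (T.inc c .back))

/-- Every coloring of `T` extends, from the semiarcs named by `i`, to a coloring of `T'`; a coloring
of `T'` is determined by the colors of these semiarcs. -/
structure Extends {n n' : ℕ} {A : Type*} (T : Tangle n) (T' : Tangle n') (i : A → T.Arc)
    (i' : A → T'.Arc) (X : Type*) [PsyOps X] : Prop where
  exists_coloring : ∀ f : T.Arc → X, T.IsColoring f → ∃ f', T'.IsColoring f' ∧ f' ∘ i' = f ∘ i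
  unique : ∀ f f' : T'.Arc → X, T'.IsColoring f → T'.IsColoring f' → f ∘ i' = f' ∘ i' → f = f'

end Tangle

namespace Diagram

open Presented

theorem eval_eq_of_crossingRel {D : Diagram} {G : Type*} {R : Word G → Word G → Prop} {pI : Prop}
    {f : D.Arc → Presented G R pI} (hf : D.IsColoring f) (x y : Word D.Arc)
    (h : D.CrossingRel x y) : eval f x = eval f y := by
  cases h with
  | topRight c => exact (hf c).1.trans (by cases D.kind c <;> rfl)
  | bottomRight c => exact (hf c).2.trans (by cases D.kind c <;> rfl)

theorem isColoring_gen (D : Diagram) (pI : Prop) :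
    D.IsColoring fun g => Presented.mk D.CrossingRel pI (.gen g) := fun c =>
  ⟨(sound (.rel (.topRight c))).trans (by cases D.kind c <;> rfl),
    (sound (.rel (.bottomRight c))).trans (by cases D.kind c <;> rfl)⟩

theorem isColoring_lift {D : Diagram} {n : ℕ} {T : Tangle n} {G : Type*}
    {R : Word G → Word G → Prop} {pI : Prop} {f : D.Arc → Presented G R pI}
    (hf : ∀ x y, D.CrossingRel x y → eval f x = eval f y)
    {g : T.Arc → Presented D.Arc D.CrossingRel pI} (hg : T.IsColoring g) :
    T.IsColoring fun a => lift f hf (g a) := by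
  intro c
  obtain ⟨h₁, h₂⟩ := hg c
  refine ⟨(congrArg (lift f hf) h₁).trans ?_, (congrArg (lift f hf) h₂).trans ?_⟩ <;>
    cases T.kind c <;> exact lift_op f hf _ _ _

/-- This is a Yoneda argument. The generic coloring of each diagram extends to a coloring of the
other, hence to maps both ways. A composite carries the generic coloring to a coloring that agrees
with it on the common semiarcs `A`, hence everywhere. -/
theorem nonempty_psyIso_of_extends {D D' : Diagram} {pI : Prop} {A : Type*} (i : A → D.Arc)
    (i' : A → D'.Arc)
    (h : ∀ (X : Type) [Psyquandle X], (pI → IsPIAdequate X) → D.Extends D'.toTangle i i' X)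
    (h' : ∀ (X : Type) [Psyquandle X], (pI → IsPIAdequate X) → D'.Extends D.toTangle i' i X) :
    Nonempty (PsyIso (Presented D.Arc D.CrossingRel pI) (Presented D'.Arc D'.CrossingRel pI)) := by
  obtain ⟨f, hf, hfi⟩ := (h' _ isPIAdequate).exists_coloring _ (D'.isColoring_gen pI)
  obtain ⟨g, hg, hgi⟩ := (h _ isPIAdequate).exists_coloring _ (D.isColoring_gen pI)
  refine nonempty_psyIso f (eval_eq_of_crossingRel hf) g (eval_eq_of_crossingRel hg)
    (congrFun ((h' _ isPIAdequate).unique _ _ (isColoring_lift _ hf) (D.isColoring_gen pI) ?_))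
    (congrFun ((h _ isPIAdequate).unique _ _ (isColoring_lift _ hg) (D'.isColoring_gen pI) ?_))
  · exact (congrArg (lift g _ ∘ ·) hfi).trans hgi
  · exact (congrArg (lift f _ ∘ ·) hgi).trans hfi

end Diagram

/-! ### Gluing and relabelling of colored diagrams -/

namespace Tangle

/-- The semiarcs at the marked points of the boundary. -/
def boundary {n : ℕ} (T : Tangle n) : Fin n ⊕ Fin n → T.Arc := Sum.elim T.entry T.exit

section

variable {n : ℕ} {X : Type*} [PsyOps X]

theorem isColoring_glue {C T : Tangle n} {f : (C.glue T).Arc → X} :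
    (C.glue T).IsColoring f ↔
      C.IsColoring (fun a => f (Quot.mk _ (.inl a))) ∧
        T.IsColoring (fun a => f (Quot.mk _ (.inr a))) :=
  Sum.forall

/-- Each identification made by gluing joins a boundary semiarc of the inner picture to a semiarc of
`C`. A replacement with the same boundary colors therefore fits, and the colors on `C` fix the
boundary colors inside. -/
theorem Extends.glue {T T' : Tangle n} (h : T.Extends T' T.boundary T'.boundary X)
    (C : Tangle n) :
    (C.glue T).Extends (C.glue T') (fun a => Quot.mk _ (.inl a)) (fun a => Quot.mk _ (.inl a))
      X where
  exists_coloring f hf := by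
    obtain ⟨hC, hT⟩ := isColoring_glue.1 hf
    obtain ⟨f', hf', e⟩ := h.exists_coloring _ hT
    refine ⟨Quot.lift (Sum.elim (fun a => f (Quot.mk _ (.inl a))) f') ?_,
      isColoring_glue.2 ⟨hC, hf'⟩, rfl⟩
    rintro _ _ (i | i)
    · exact (congrArg f (Quot.sound (.into i))).trans (congrFun e (.inl i)).symm
    · exact (congrFun e (.inr i)).trans (congrArg f (Quot.sound (.back i)))
  unique f f' hf hf' e := by
    have := h.unique _ _ (isColoring_glue.1 hf).2 (isColoring_glue.1 hf').2 <| by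
      ext (i | i)
      · have hi : (Quot.mk _ (.inr (T'.entry i)) : (C.glue T').Arc) = Quot.mk _ (.inl (C.exit i)) :=
          (Quot.sound (.into i)).symm
        exact (congrArg f hi).trans ((congrFun e _).trans (congrArg f' hi).symm)
      · have hi : (Quot.mk _ (.inr (T'.exit i)) : (C.glue T').Arc) = Quot.mk _ (.inl (C.entry i)) :=
          Quot.sound (.back i)
        exact (congrArg f hi).trans ((congrFun e _).trans (congrArg f' hi).symm)
    funext a
    obtain ⟨a | a, rfl⟩ := Quot.exists_rep a
    exacts [congrFun e a, congrFun this a]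

theorem Iso.isColoring_comp_iff {T T' : Tangle n} (e : T.Iso T') {f : T'.Arc → X} :
    T.IsColoring (f ∘ e.arc) ↔ T'.IsColoring f := by
  unfold IsColoring
  rw [← e.cr.forall_congr_right]
  simp only [e.kind_eq, e.inc_eq, e.out_eq, Function.comp_apply]

theorem Iso.extends {A : Type*} {S S' T T' : Tangle n} (e : T.Iso S) (e' : T'.Iso S')
    {i : A → S.Arc} {i' : A → S'.Arc} (h : S.Extends S' i i' X) :
    T.Extends T' (e.arc.symm ∘ i) (e'.arc.symm ∘ i') X where
  exists_coloring f hf := by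
    obtain ⟨f', hf', hi⟩ := h.exists_coloring (f ∘ e.arc.symm)
      (e.isColoring_comp_iff.1 (by simpa [Function.comp_assoc] using hf))
    exact ⟨f' ∘ e'.arc, e'.isColoring_comp_iff.2 hf', by
      rw [← Function.comp_assoc, Function.comp_assoc f']; simpa [Function.comp_assoc] using hi⟩
  unique f f' hf hf' hi := by
    have := h.unique (f ∘ e'.arc.symm) (f' ∘ e'.arc.symm)
      (e'.isColoring_comp_iff.1 (by simpa [Function.comp_assoc] using hf))
      (e'.isColoring_comp_iff.1 (by simpa [Function.comp_assoc] using hf')) hi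
    funext a
    simpa using congrFun this (e'.arc a)

/-- The identity. -/
def Iso.refl (T : Tangle n) : T.Iso T where
  arc := Equiv.refl _
  cr := Equiv.refl _
  kind_eq _ := rfl
  inc_eq _ _ := rfl
  out_eq _ _ := rfl
  entry_eq _ := rfl
  exit_eq _ := rfl

theorem extends_refl (T : Tangle n) : T.Extends T id id X :=
  ⟨fun f hf => ⟨f, hf, rfl⟩, fun _ _ _ _ h => h⟩

/-- Two diagrams with the same boundary admit the same colors on the boundary, which determine the
colors of all semiarcs. -/
def SameColors (T T' : Tangle n) (X : Type*) [PsyOps X] : Prop :=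
  T.Extends T' T.boundary T'.boundary X ∧ T'.Extends T T'.boundary T.boundary X

end

end Tangle

open Tangle

/-! ## Colorings of the local pictures -/

section Lines

variable {n : ℕ} {X : Type*}

/-- Reversing a line only swaps its entry and its exit, so boundary conditions can be stated along
the reference directions, for all orientations at once. -/
theorem comp_boundary_eq_iff {m m' k k' : ℕ} {fwd : Fin n → Bool}
    {c : Fin k → LineCrossing n m} {c' : Fin k' → LineCrossing n m'}
    {f : Fin n × Fin (m + 1) → X} {f' : Fin n × Fin (m' + 1) → X} :
    f ∘ (lineTangle fwd c).boundary = f' ∘ (lineTangle fwd c').boundary ↔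
      ∀ i, f (i, 0) = f' (i, 0) ∧ f (i, Fin.last m) = f' (i, Fin.last m') := by
  simp only [funext_iff, Sum.forall, ← forall_and]
  refine forall_congr' fun i => ?_
  cases h : fwd i
  · simpa [boundary, lineTangle, h] using and_comm
  · simp [boundary, lineTangle, h]

/-- The colors `u i`, `v i`, `w i` on the three semiarcs of line `i`. -/
def threeColors (u v w : Fin n → X) : Fin n × Fin 3 → X := fun a => ![u a.1, v a.1, w a.1] a.2

theorem eq_threeColors (f : Fin n × Fin 3 → X) :
    f = threeColors (fun i => f (i, 0)) (fun i => f (i, 1)) (fun i => f (i, 2)) := by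
  funext ⟨i, j⟩
  fin_cases j <;> rfl

variable [PsyOps X] {k k' : ℕ} {fwd : Fin n → Bool} {c : Fin k → LineCrossing n 2}
  {c' : Fin k' → LineCrossing n 2} {P P' : (Fin n → X) → (Fin n → X) → (Fin n → X) → Prop}

theorem lineTangle_unique
    (h : ∀ u v w, (lineTangle fwd c).IsColoring (threeColors u v w) ↔ P u v w)
    (un : ∀ u v v' w, P u v w → P u v' w → v = v') (f f' : Fin n × Fin 3 → X)
    (hf : (lineTangle fwd c).IsColoring f) (hf' : (lineTangle fwd c).IsColoring f')
    (e : ∀ i, f (i, 0) = f' (i, 0) ∧ f (i, 2) = f' (i, 2)) : f = f' := by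
  rw [eq_threeColors f] at hf ⊢
  rw [eq_threeColors f'] at hf' ⊢
  simp only [(e _).1, (e _).2] at hf ⊢
  rw [un _ _ _ _ ((h _ _ _).1 hf) ((h _ _ _).1 hf')]

theorem lineTangle_extends
    (h : ∀ u v w, (lineTangle fwd c).IsColoring (threeColors u v w) ↔ P u v w)
    (h' : ∀ u v w, (lineTangle fwd c').IsColoring (threeColors u v w) ↔ P' u v w)
    (ex : ∀ u v w, P u v w → ∃ v', P' u v' w) (un : ∀ u v v' w, P' u v w → P' u v' w → v = v') :
    (lineTangle fwd c).Extends (lineTangle fwd c') (lineTangle fwd c).boundary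
      (lineTangle fwd c').boundary X where
  exists_coloring f hf := by
    rw [eq_threeColors f] at hf
    obtain ⟨v', hv'⟩ := ex _ _ _ ((h _ _ _).1 hf)
    exact ⟨_, (h' _ v' _).2 hv', comp_boundary_eq_iff.2 fun i => ⟨rfl, rfl⟩⟩
  unique f f' hf hf' e :=
    lineTangle_unique h' un f f' hf hf' (comp_boundary_eq_iff.1 e)

/-- Reduces a move to conditions `P`, `P'` on the first, middle and last colors `u`, `v`, `w` of the
lines: they allow the same `u`, `w`, and these determine `v`. -/
theorem lineTangle_sameColors
    (h : ∀ u v w, (lineTangle fwd c).IsColoring (threeColors u v w) ↔ P u v w)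
    (h' : ∀ u v w, (lineTangle fwd c').IsColoring (threeColors u v w) ↔ P' u v w)
    (ex : ∀ u v w, P u v w → ∃ v', P' u v' w) (ex' : ∀ u v w, P' u v w → ∃ v', P u v' w)
    (un : ∀ u v v' w, P u v w → P u v' w → v = v')
    (un' : ∀ u v v' w, P' u v w → P' u v' w → v = v') :
    (lineTangle fwd c).SameColors (lineTangle fwd c') X :=
  ⟨lineTangle_extends h h' ex un', lineTangle_extends h' h ex' un⟩

theorem lineTangle_sameColors_uncrossed
    (h : ∀ u v w, (lineTangle fwd c).IsColoring (threeColors u v w) ↔ P u v w)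
    (eq : ∀ u v w, P u v w → u = w) (ex : ∀ u, ∃ v, P u v u)
    (un : ∀ u v v', P u v u → P u v' u → v = v') :
    (lineTangle fwd c).SameColors (uncrossed fwd) X := by
  refine ⟨⟨fun f hf => ?_, fun f f' _ _ e => ?_⟩, ⟨fun f _ => ?_, fun f f' hf hf' e => ?_⟩⟩
  · rw [eq_threeColors f] at hf
    have := eq _ _ _ ((h _ _ _).1 hf)
    exact ⟨fun a => f (a.1, 0), fun j => j.elim0,
      comp_boundary_eq_iff.2 fun i => ⟨rfl, congrFun this i⟩⟩
  · funext ⟨i, j⟩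
    obtain rfl : j = 0 := Fin.fin_one_eq_zero j
    exact (comp_boundary_eq_iff.1 e i).1
  · obtain ⟨v, hv⟩ := ex fun i => f (i, 0)
    exact ⟨_, (h _ v _).2 hv, comp_boundary_eq_iff.2 fun i => ⟨rfl, rfl⟩⟩
  · refine lineTangle_unique h (fun u v v' w hv hv' => ?_) f f' hf hf' (comp_boundary_eq_iff.1 e)
    obtain rfl := eq _ _ _ hv
    exact un _ _ _ hv hv'

end Lines

open Tangle

/-! ## Invariance under the moves -/

theorem funext_two {X : Type*} {u v : Fin 2 → X} (h₀ : u 0 = v 0) (h₁ : u 1 = v 1) : u = v := by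
  funext i; fin_cases i <;> assumption

theorem funext_three {X : Type*} {u v : Fin 3 → X} (h : u 0 = v 0 ∧ u 1 = v 1 ∧ u 2 = v 2) : u = v := by
  obtain ⟨h₀, h₁, h₂⟩ := h
  funext i; fin_cases i <;> assumption

section Moves

variable {X : Type*} [Psyquandle X]

/-- Reversing just one line interchanges `slash` and `back`, and with them the two heights. -/
theorem kind_heightType {n m : ℕ} (a b : Fin n) (i j : Fin m) (p q : Fin 3)
    (fwd : Fin n → Bool) :
    (⟨a, b, i, j, heightType p q⟩ : LineCrossing n m).kind fwd =
      if fwd a = fwd b then kindOfHeights p q else kindOfHeights q p := by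
  unfold LineCrossing.kind heightType kindOfHeights
  rcases lt_trichotomy p q with h | rfl | h
  · simp [h.ne, h.ne', h.not_gt, h]
  · simp
  · simp [h.ne, h.ne', h.not_gt, h]

/-- The kind of a crossing of the given type whose strands run along the reference directions. -/
def CrossType.toKind : CrossType → Kind
  | .aOver => .pos
  | .bOver => .neg
  | .flat => .flat

/-- The loop occupies both left-hand or both right-hand semiarcs of the crossing, according to the
orientation. Equal colors on one side are equivalent to equal colors on the other. -/
theorem sameColors_kink (fwd : Fin 1 → Bool) (t : CrossType)
    (ht : t = .flat → IsPIAdequate X) : (kink fwd t).SameColors (uncrossed fwd) X := by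
  have hk : t.toKind = .flat → IsPIAdequate X := by
    cases t <;> simp_all [CrossType.toKind]
  cases h₀ : fwd 0
  · refine lineTangle_sameColors_uncrossed
      (P := fun u v w => Meets t.toKind (v 0) (v 0) (u 0) (w 0)) (fun u v w => ?_)
      (fun u v w h => ?_) (fun u => ?_) (fun u v v' h h' => ?_)
    · cases t <;>
        simp [IsColoring, lineTangle, LineCrossing.pass, LineCrossing.kind, threeColors, h₀,
          CrossType.toKind]
    · funext i; rw [Fin.fin_one_eq_zero i]; exact h.right_eq hk
    · obtain ⟨a, b, h⟩ := Meets.exists_left t.toKind (u 0) (u 0)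
      obtain rfl := h.left_eq hk
      exact ⟨fun _ => a, h⟩
    · funext i; rw [Fin.fin_one_eq_zero i]; exact (h.left_unique h').1
  · refine lineTangle_sameColors_uncrossed
      (P := fun u v w => Meets t.toKind (u 0) (w 0) (v 0) (v 0)) (fun u v w => ?_)
      (fun u v w h => ?_) (fun u => ?_) (fun u v v' h h' => ?_)
    · cases t <;>
        simp [IsColoring, lineTangle, LineCrossing.pass, LineCrossing.kind, threeColors, h₀,
          CrossType.toKind]
    · funext i; rw [Fin.fin_one_eq_zero i]; exact h.left_eq hk
    · exact ⟨fun _ => t.toKind.topRight (u 0) (u 0), rfl, Kind.topRight_self hk _⟩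
    · funext i; rw [Fin.fin_one_eq_zero i]; exact (h.right_unique h').1

/-- The kind of the crossing when its over-strand becomes the under-strand. -/
def Kind.opp : Kind → Kind
  | .pos => .neg
  | .neg => .pos
  | .flat => .flat

theorem Meets.opp {k : Kind} (hk : k ≠ .flat) {a b c d : X} :
    Meets k.opp a b c d ↔ Meets k b a d c := by
  cases k
  exacts [meets_pos_iff_neg.symm, meets_pos_iff_neg, absurd rfl hk]

/-- The type of the crossing when its over-line becomes the under-line. -/
def CrossType.opp : CrossType → CrossType
  | .aOver => .bOver
  | .bOver => .aOver
  | .flat => .flat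

/-- Up to `meets_pos_iff_neg`, both crossings satisfy the same relation with the same inner colors
in the same two neighbouring places. These determine the outer colors, which therefore agree at the
two ends, and conversely. -/
theorem sameColors_bigon_uncrossed (fwd : Fin 2 → Bool) (t : CrossType) (ht : t ≠ .flat) :
    (bigon fwd t t.opp).SameColors (uncrossed fwd) X := by
  cases h₀ : fwd 0 <;> cases h₁ : fwd 1
  · refine lineTangle_sameColors_uncrossed
      (P := fun u v w => Meets t.toKind (v 0) (u 1) (u 0) (v 1) ∧
        Meets t.toKind (v 0) (w 1) (w 0) (v 1))
      (fun u v w => ?_) (fun u v w h => ?_) (fun u => ?_) (fun u v v' h h' => ?_)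
    · cases t <;>
        simp [IsColoring, lineTangle, LineCrossing.pass, LineCrossing.kind, threeColors, h₀, h₁,
          CrossType.toKind, CrossType.opp, Fin.forall_fin_succ, meets_pos_iff_neg] at ht ⊢
    · obtain ⟨h₁, h₂⟩ := h
      have e := h₁.top_left_unique h₂
      rw [e] at h₁
      exact funext_two (h₁.right_unique h₂).1 e
    · obtain ⟨a, d, h⟩ := Meets.exists_bottom t.toKind (u 1) (u 0)
      exact ⟨![a, d], h, h⟩
    · have e := h.1.bottom_left_unique h'.1
      have h₁ := h.1
      rw [e] at h₁
      exact funext_two e (h₁.right_unique h'.1).2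
  · refine lineTangle_sameColors_uncrossed
      (P := fun u v w => Meets t.toKind.opp (u 1) (u 0) (v 1) (v 0) ∧
        Meets t.toKind.opp (w 1) (w 0) (v 1) (v 0))
      (fun u v w => ?_) (fun u v w h => ?_) (fun u => ?_) (fun u v v' h h' => ?_)
    · cases t <;>
        simp [IsColoring, lineTangle, LineCrossing.pass, LineCrossing.kind, threeColors, h₀, h₁,
          CrossType.toKind, CrossType.opp, Kind.opp, Fin.forall_fin_succ,
          meets_pos_iff_neg] at ht ⊢
    · obtain ⟨e₁, e₂⟩ := h.1.left_unique h.2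
      exact funext_two e₂ e₁
    · obtain ⟨c, d, h⟩ := Meets.exists_right t.toKind.opp (u 1) (u 0)
      exact ⟨![d, c], h, h⟩
    · obtain ⟨e₁, e₂⟩ := h.1.right_unique h'.1
      exact funext_two e₂ e₁
  · refine lineTangle_sameColors_uncrossed
      (P := fun u v w => Meets t.toKind.opp (v 1) (v 0) (u 1) (u 0) ∧
        Meets t.toKind.opp (v 1) (v 0) (w 1) (w 0))
      (fun u v w => ?_) (fun u v w h => ?_) (fun u => ?_) (fun u v v' h h' => ?_)
    · cases t <;>
        simp [IsColoring, lineTangle, LineCrossing.pass, LineCrossing.kind, threeColors, h₀, h₁,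
          CrossType.toKind, CrossType.opp, Kind.opp, Fin.forall_fin_succ,
          meets_pos_iff_neg] at ht ⊢
    · obtain ⟨e₁, e₂⟩ := h.1.right_unique h.2
      exact funext_two e₂ e₁
    · obtain ⟨c, d, h⟩ := Meets.exists_left t.toKind.opp (u 1) (u 0)
      exact ⟨![d, c], h, h⟩
    · obtain ⟨e₁, e₂⟩ := h.1.left_unique h'.1
      exact funext_two e₂ e₁
  · refine lineTangle_sameColors_uncrossed
      (P := fun u v w => Meets t.toKind (u 0) (v 1) (v 0) (u 1) ∧
        Meets t.toKind (w 0) (v 1) (v 0) (w 1))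
      (fun u v w => ?_) (fun u v w h => ?_) (fun u => ?_) (fun u v v' h h' => ?_)
    · cases t <;>
        simp [IsColoring, lineTangle, LineCrossing.pass, LineCrossing.kind, threeColors, h₀, h₁,
          CrossType.toKind, CrossType.opp, Fin.forall_fin_succ, meets_pos_iff_neg] at ht ⊢
    · obtain ⟨h₁, h₂⟩ := h
      have e := h₁.bottom_left_unique h₂
      rw [e] at h₁
      exact funext_two e (h₁.right_unique h₂).2
    · obtain ⟨b, c, h⟩ := Meets.exists_top t.toKind (u 0) (u 1)
      exact ⟨![c, b], h, h⟩
    · have e := h.1.top_left_unique h'.1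
      have h₁ := h.1
      rw [e] at h₁
      exact funext_two (h₁.right_unique h'.1).1 e

theorem sameColors_flatTwist (fwd : Fin 2 → Bool) (t : CrossType) (ht : t ≠ .flat) :
    (bigon fwd t .flat).SameColors (bigon fwd .flat t) X := by
  have hk : t.toKind ≠ .flat := by cases t <;> simp_all [CrossType.toKind]
  have hk' : t.toKind.opp ≠ .flat := by cases t <;> simp_all [CrossType.toKind, Kind.opp]
  cases h₀ : fwd 0 <;> cases h₁ : fwd 1
  -- The crossing at the start of the lines already determines the inner colors, whatever its kind,
  -- so the same argument serves both pictures.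
  · have un (k : Kind) {k' : Kind} {u v v' w : Fin 2 → X}
        (h : Meets k (v 0) (u 1) (u 0) (v 1) ∧ Meets k' (w 1) (v 0) (v 1) (w 0))
        (h' : Meets k (v' 0) (u 1) (u 0) (v' 1) ∧ Meets k' (w 1) (v' 0) (v' 1) (w 0)) :
        v = v' := by
      have e := h.1.bottom_left_unique h'.1
      have h₁ := h.1
      rw [e] at h₁
      exact funext_two e (h₁.right_unique h'.1).2
    refine lineTangle_sameColors
      (P := fun u v w => Meets t.toKind (v 0) (u 1) (u 0) (v 1) ∧
        Meets .flat (w 1) (v 0) (v 1) (w 0))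
      (P' := fun u v w => Meets .flat (v 0) (u 1) (u 0) (v 1) ∧
        Meets t.toKind (w 1) (v 0) (v 1) (w 0))
      (fun u v w => ?_) (fun u v w => ?_) (fun u v w h => ?_) (fun u v w h => ?_)
      (fun u v v' w => un _) (fun u v v' w => un _)
    · cases t <;>
        simp [IsColoring, lineTangle, LineCrossing.pass, LineCrossing.kind, threeColors, h₀, h₁,
          CrossType.toKind, Fin.forall_fin_succ] at ht ⊢
    · cases t <;>
        simp [IsColoring, lineTangle, LineCrossing.pass, LineCrossing.kind, threeColors, h₀, h₁,
          CrossType.toKind, Fin.forall_fin_succ] at ht ⊢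
    · obtain ⟨x, y, g₁, g₂⟩ := (exists_classical_flat_iff hk).2 ⟨_, _, h.2, h.1⟩
      exact ⟨![y, x], g₂, g₁⟩
    · obtain ⟨x, y, g₁, g₂⟩ := (exists_classical_flat_iff hk).1 ⟨_, _, h.2, h.1⟩
      exact ⟨![y, x], g₂, g₁⟩
  · have un (k : Kind) {k' : Kind} {u v v' w : Fin 2 → X}
        (h : Meets k (u 1) (u 0) (v 1) (v 0) ∧ Meets k' (w 0) (w 1) (v 0) (v 1))
        (h' : Meets k (u 1) (u 0) (v' 1) (v' 0) ∧ Meets k' (w 0) (w 1) (v' 0) (v' 1)) :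
        v = v' := by
      obtain ⟨e₁, e₂⟩ := h.1.right_unique h'.1
      exact funext_two e₂ e₁
    refine lineTangle_sameColors
      (P := fun u v w => Meets t.toKind.opp (u 1) (u 0) (v 1) (v 0) ∧
        Meets .flat (w 0) (w 1) (v 0) (v 1))
      (P' := fun u v w => Meets .flat (u 1) (u 0) (v 1) (v 0) ∧
        Meets t.toKind.opp (w 0) (w 1) (v 0) (v 1))
      (fun u v w => ?_) (fun u v w => ?_) (fun u v w h => ?_) (fun u v w h => ?_)
      (fun u v v' w => un _) (fun u v v' w => un _)
    · cases t <;>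
        simp [IsColoring, lineTangle, LineCrossing.pass, LineCrossing.kind, threeColors, h₀, h₁,
          CrossType.toKind, Kind.opp, Fin.forall_fin_succ] at ht ⊢
    · cases t <;>
        simp [IsColoring, lineTangle, LineCrossing.pass, LineCrossing.kind, threeColors, h₀, h₁,
          CrossType.toKind, Kind.opp, Fin.forall_fin_succ] at ht ⊢
    · obtain ⟨c, d, g₁, g₂⟩ := h.2.flat_side hk ((Meets.opp hk).1 h.1)
      exact ⟨![d, c], g₁, (Meets.opp hk).2 g₂⟩
    · obtain ⟨c, d, g₁, g₂⟩ := h.1.flat_side hk ((Meets.opp hk).1 h.2)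
      exact ⟨![c, d], (Meets.opp hk).2 g₂, g₁⟩
  · have un (k : Kind) {k' : Kind} {u v v' w : Fin 2 → X}
        (h : Meets k (v 1) (v 0) (u 1) (u 0) ∧ Meets k' (v 0) (v 1) (w 0) (w 1))
        (h' : Meets k (v' 1) (v' 0) (u 1) (u 0) ∧ Meets k' (v' 0) (v' 1) (w 0) (w 1)) :
        v = v' := by
      obtain ⟨e₁, e₂⟩ := h.1.left_unique h'.1
      exact funext_two e₂ e₁
    refine lineTangle_sameColors
      (P := fun u v w => Meets t.toKind.opp (v 1) (v 0) (u 1) (u 0) ∧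
        Meets .flat (v 0) (v 1) (w 0) (w 1))
      (P' := fun u v w => Meets .flat (v 1) (v 0) (u 1) (u 0) ∧
        Meets t.toKind.opp (v 0) (v 1) (w 0) (w 1))
      (fun u v w => ?_) (fun u v w => ?_) (fun u v w h => ?_) (fun u v w h => ?_)
      (fun u v v' w => un _) (fun u v v' w => un _)
    · cases t <;>
        simp [IsColoring, lineTangle, LineCrossing.pass, LineCrossing.kind, threeColors, h₀, h₁,
          CrossType.toKind, Kind.opp, Fin.forall_fin_succ] at ht ⊢
    · cases t <;>
        simp [IsColoring, lineTangle, LineCrossing.pass, LineCrossing.kind, threeColors, h₀, h₁,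
          CrossType.toKind, Kind.opp, Fin.forall_fin_succ] at ht ⊢
    -- Here the bigon lies to the left of both crossings, whereas `Meets.flat_side` concerns shared
    -- right-hand colors. It is applied to the old and the new crossing at the end `w`, which share
    -- their right-hand colors; its conclusion identifies the colors at the end `u`.
    · obtain ⟨p, q, g⟩ := Meets.exists_left t.toKind.opp (w 0) (w 1)
      obtain ⟨c, d, g₁, g₂⟩ := h.2.flat_side hk' g
      obtain ⟨rfl, rfl⟩ := h.1.right_unique g₂
      exact ⟨![p, q], g₁, g⟩
    · obtain ⟨p, q, g⟩ := Meets.exists_left .flat (w 0) (w 1)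
      obtain ⟨c, d, g₁, g₂⟩ := g.flat_side hk' h.2
      obtain ⟨rfl, rfl⟩ := h.1.right_unique g₁
      exact ⟨![p, q], g₂, g⟩
  · have un (k : Kind) {k' : Kind} {u v v' w : Fin 2 → X}
        (h : Meets k (u 0) (v 1) (v 0) (u 1) ∧ Meets k' (v 1) (w 0) (w 1) (v 0))
        (h' : Meets k (u 0) (v' 1) (v' 0) (u 1) ∧ Meets k' (v' 1) (w 0) (w 1) (v' 0)) :
        v = v' := by
      have e := h.1.top_left_unique h'.1
      have h₁ := h.1
      rw [e] at h₁
      exact funext_two (h₁.right_unique h'.1).1 e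
    refine lineTangle_sameColors
      (P := fun u v w => Meets t.toKind (u 0) (v 1) (v 0) (u 1) ∧
        Meets .flat (v 1) (w 0) (w 1) (v 0))
      (P' := fun u v w => Meets .flat (u 0) (v 1) (v 0) (u 1) ∧
        Meets t.toKind (v 1) (w 0) (w 1) (v 0))
      (fun u v w => ?_) (fun u v w => ?_) (fun u v w h => ?_) (fun u v w h => ?_)
      (fun u v v' w => un _) (fun u v v' w => un _)
    · cases t <;>
        simp [IsColoring, lineTangle, LineCrossing.pass, LineCrossing.kind, threeColors, h₀, h₁,
          CrossType.toKind, Fin.forall_fin_succ] at ht ⊢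
    · cases t <;>
        simp [IsColoring, lineTangle, LineCrossing.pass, LineCrossing.kind, threeColors, h₀, h₁,
          CrossType.toKind, Fin.forall_fin_succ] at ht ⊢
    · obtain ⟨x, y, g₁, g₂⟩ := (exists_classical_flat_iff hk).1 ⟨_, _, h⟩
      exact ⟨![x, y], g₁, g₂⟩
    · obtain ⟨x, y, g₁, g₂⟩ := (exists_classical_flat_iff hk).2 ⟨_, _, h⟩
      exact ⟨![x, y], g₁, g₂⟩

/-- The triangle is cyclically oriented exactly when line `1` runs against both other lines. In the
remaining six cases all strands can be turned upwards, which rotates the roles of the lines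
cyclically and may interchange the two sides of the triangle. -/
theorem sameColors_triangle (fwd : Fin 3 → Bool) (h : Fin 3 → Fin 3) (hh : ∃ i j, h i ≠ h j) :
    (triangle fwd h).SameColors (triangle' fwd h) X := by
  have h₀₁₂ : ¬(h 0 = h 1 ∧ h 1 = h 2) := by
    rintro ⟨e₁, e₂⟩
    obtain ⟨i, j, hij⟩ := hh
    fin_cases i <;> fin_cases j <;> simp_all
  have h₁₂₀ : ¬(h 1 = h 2 ∧ h 2 = h 0) := fun ⟨e₁, e₂⟩ => h₀₁₂ ⟨(e₁.trans e₂).symm, e₁⟩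
  have h₂₀₁ : ¬(h 2 = h 0 ∧ h 0 = h 1) := fun ⟨e₁, e₂⟩ => h₀₁₂ ⟨e₂, (e₁.trans e₂).symm⟩
  cases f₀ : fwd 0 <;> cases f₁ : fwd 1 <;> cases f₂ : fwd 2
  · refine lineTangle_sameColors
      (P := fun u v w => UpperTriangle (h 0) (h 1) (h 2)
        (w 0) (v 0) (u 0) (w 1) (v 1) (u 1) (w 2) (v 2) (u 2))
      (P' := fun u v w => LowerTriangle (h 0) (h 1) (h 2)
        (w 0) (v 0) (u 0) (w 1) (v 1) (u 1) (w 2) (v 2) (u 2))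
      (fun u v w => ?_) (fun u v w => ?_)
      (fun u v w g => ?_) (fun u v w g => ?_)
      (fun u v v' w g g' => funext_three (g.unique g'))
      (fun u v v' w g g' => funext_three (g.unique g'))
    · simp [IsColoring, lineTangle, LineCrossing.pass, kind_heightType, threeColors, f₀, f₁, f₂,
        Fin.forall_fin_succ, UpperTriangle]
    · simp [IsColoring, lineTangle, LineCrossing.pass, kind_heightType, threeColors, f₀, f₁, f₂,
        Fin.forall_fin_succ, LowerTriangle]
    · obtain ⟨x, y, z, g⟩ := g.exists_lower h₀₁₂
      exact ⟨![x, y, z], g⟩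
    · obtain ⟨x, y, z, g⟩ := g.exists_upper h₀₁₂
      exact ⟨![x, y, z], g⟩
  · refine lineTangle_sameColors
      (P := fun u v w => LowerTriangle (h 2) (h 0) (h 1)
        (u 2) (v 2) (w 2) (w 0) (v 0) (u 0) (w 1) (v 1) (u 1))
      (P' := fun u v w => UpperTriangle (h 2) (h 0) (h 1)
        (u 2) (v 2) (w 2) (w 0) (v 0) (u 0) (w 1) (v 1) (u 1))
      (fun u v w => ?_) (fun u v w => ?_)
      (fun u v w g => ?_) (fun u v w g => ?_)
      (fun u v v' w g g' => funext_three ⟨(g.unique g').2.1, (g.unique g').2.2, (g.unique g').1⟩)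
      (fun u v v' w g g' => funext_three ⟨(g.unique g').2.1, (g.unique g').2.2, (g.unique g').1⟩)
    · simp [IsColoring, lineTangle, LineCrossing.pass, kind_heightType, threeColors, f₀, f₁, f₂,
        Fin.forall_fin_succ, LowerTriangle, and_comm, and_left_comm]
    · simp [IsColoring, lineTangle, LineCrossing.pass, kind_heightType, threeColors, f₀, f₁, f₂,
        Fin.forall_fin_succ, UpperTriangle, and_comm, and_left_comm]
    · obtain ⟨x, y, z, g⟩ := g.exists_upper h₂₀₁
      exact ⟨![y, z, x], g⟩
    · obtain ⟨x, y, z, g⟩ := g.exists_lower h₂₀₁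
      exact ⟨![y, z, x], g⟩
  · refine lineTangle_sameColors
      (P := fun u v w => OuterTriangle (h 0) (h 1) (h 2)
        (w 0) (v 0) (u 0) (w 1) (v 1) (u 1) (w 2) (v 2) (u 2))
      (P' := fun u v w => InnerTriangle (h 0) (h 1) (h 2)
        (w 0) (v 0) (u 0) (w 1) (v 1) (u 1) (w 2) (v 2) (u 2))
      (fun u v w => ?_) (fun u v w => ?_)
      (fun u v w g => ?_) (fun u v w g => ?_)
      (fun u v v' w g g' => funext_three (g.unique g'))
      (fun u v v' w g g' => funext_three (g.unique g'))
    · simp [IsColoring, lineTangle, LineCrossing.pass, kind_heightType, threeColors, f₀, f₁, f₂,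
        Fin.forall_fin_succ, OuterTriangle]
    · simp [IsColoring, lineTangle, LineCrossing.pass, kind_heightType, threeColors, f₀, f₁, f₂,
        Fin.forall_fin_succ, InnerTriangle]
    · obtain ⟨x, y, z, g⟩ := g.exists_inner h₀₁₂
      exact ⟨![x, y, z], g⟩
    · obtain ⟨x, y, z, g⟩ := g.exists_outer h₀₁₂
      exact ⟨![x, y, z], g⟩
  · refine lineTangle_sameColors
      (P := fun u v w => UpperTriangle (h 1) (h 2) (h 0)
        (u 1) (v 1) (w 1) (u 2) (v 2) (w 2) (w 0) (v 0) (u 0))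
      (P' := fun u v w => LowerTriangle (h 1) (h 2) (h 0)
        (u 1) (v 1) (w 1) (u 2) (v 2) (w 2) (w 0) (v 0) (u 0))
      (fun u v w => ?_) (fun u v w => ?_)
      (fun u v w g => ?_) (fun u v w g => ?_)
      (fun u v v' w g g' => funext_three ⟨(g.unique g').2.2, (g.unique g').1, (g.unique g').2.1⟩)
      (fun u v v' w g g' => funext_three ⟨(g.unique g').2.2, (g.unique g').1, (g.unique g').2.1⟩)
    · simp [IsColoring, lineTangle, LineCrossing.pass, kind_heightType, threeColors, f₀, f₁, f₂,
        Fin.forall_fin_succ, UpperTriangle, and_comm, and_left_comm]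
    · simp [IsColoring, lineTangle, LineCrossing.pass, kind_heightType, threeColors, f₀, f₁, f₂,
        Fin.forall_fin_succ, LowerTriangle, and_comm, and_left_comm]
    · obtain ⟨x, y, z, g⟩ := g.exists_lower h₁₂₀
      exact ⟨![z, x, y], g⟩
    · obtain ⟨x, y, z, g⟩ := g.exists_upper h₁₂₀
      exact ⟨![z, x, y], g⟩
  · refine lineTangle_sameColors
      (P := fun u v w => LowerTriangle (h 1) (h 2) (h 0)
        (w 1) (v 1) (u 1) (w 2) (v 2) (u 2) (u 0) (v 0) (w 0))
      (P' := fun u v w => UpperTriangle (h 1) (h 2) (h 0)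
        (w 1) (v 1) (u 1) (w 2) (v 2) (u 2) (u 0) (v 0) (w 0))
      (fun u v w => ?_) (fun u v w => ?_)
      (fun u v w g => ?_) (fun u v w g => ?_)
      (fun u v v' w g g' => funext_three ⟨(g.unique g').2.2, (g.unique g').1, (g.unique g').2.1⟩)
      (fun u v v' w g g' => funext_three ⟨(g.unique g').2.2, (g.unique g').1, (g.unique g').2.1⟩)
    · simp [IsColoring, lineTangle, LineCrossing.pass, kind_heightType, threeColors, f₀, f₁, f₂,
        Fin.forall_fin_succ, LowerTriangle, and_comm, and_left_comm]
    · simp [IsColoring, lineTangle, LineCrossing.pass, kind_heightType, threeColors, f₀, f₁, f₂,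
        Fin.forall_fin_succ, UpperTriangle, and_comm, and_left_comm]
    · obtain ⟨x, y, z, g⟩ := g.exists_upper h₁₂₀
      exact ⟨![z, x, y], g⟩
    · obtain ⟨x, y, z, g⟩ := g.exists_lower h₁₂₀
      exact ⟨![z, x, y], g⟩
  · refine lineTangle_sameColors
      (P := fun u v w => InnerTriangle (h 0) (h 1) (h 2)
        (u 0) (v 0) (w 0) (u 1) (v 1) (w 1) (u 2) (v 2) (w 2))
      (P' := fun u v w => OuterTriangle (h 0) (h 1) (h 2)
        (u 0) (v 0) (w 0) (u 1) (v 1) (w 1) (u 2) (v 2) (w 2))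
      (fun u v w => ?_) (fun u v w => ?_)
      (fun u v w g => ?_) (fun u v w g => ?_)
      (fun u v v' w g g' => funext_three (g.unique g'))
      (fun u v v' w g g' => funext_three (g.unique g'))
    · simp [IsColoring, lineTangle, LineCrossing.pass, kind_heightType, threeColors, f₀, f₁, f₂,
        Fin.forall_fin_succ, InnerTriangle]
    · simp [IsColoring, lineTangle, LineCrossing.pass, kind_heightType, threeColors, f₀, f₁, f₂,
        Fin.forall_fin_succ, OuterTriangle]
    · obtain ⟨x, y, z, g⟩ := g.exists_outer h₀₁₂
      exact ⟨![x, y, z], g⟩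
    · obtain ⟨x, y, z, g⟩ := g.exists_inner h₀₁₂
      exact ⟨![x, y, z], g⟩
  · refine lineTangle_sameColors
      (P := fun u v w => UpperTriangle (h 2) (h 0) (h 1)
        (w 2) (v 2) (u 2) (u 0) (v 0) (w 0) (u 1) (v 1) (w 1))
      (P' := fun u v w => LowerTriangle (h 2) (h 0) (h 1)
        (w 2) (v 2) (u 2) (u 0) (v 0) (w 0) (u 1) (v 1) (w 1))
      (fun u v w => ?_) (fun u v w => ?_)
      (fun u v w g => ?_) (fun u v w g => ?_)
      (fun u v v' w g g' => funext_three ⟨(g.unique g').2.1, (g.unique g').2.2, (g.unique g').1⟩)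
      (fun u v v' w g g' => funext_three ⟨(g.unique g').2.1, (g.unique g').2.2, (g.unique g').1⟩)
    · simp [IsColoring, lineTangle, LineCrossing.pass, kind_heightType, threeColors, f₀, f₁, f₂,
        Fin.forall_fin_succ, UpperTriangle, and_comm, and_left_comm]
    · simp [IsColoring, lineTangle, LineCrossing.pass, kind_heightType, threeColors, f₀, f₁, f₂,
        Fin.forall_fin_succ, LowerTriangle, and_comm, and_left_comm]
    · obtain ⟨x, y, z, g⟩ := g.exists_lower h₂₀₁
      exact ⟨![y, z, x], g⟩
    · obtain ⟨x, y, z, g⟩ := g.exists_upper h₂₀₁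
      exact ⟨![y, z, x], g⟩
  · refine lineTangle_sameColors
      (P := fun u v w => LowerTriangle (h 0) (h 1) (h 2)
        (u 0) (v 0) (w 0) (u 1) (v 1) (w 1) (u 2) (v 2) (w 2))
      (P' := fun u v w => UpperTriangle (h 0) (h 1) (h 2)
        (u 0) (v 0) (w 0) (u 1) (v 1) (w 1) (u 2) (v 2) (w 2))
      (fun u v w => ?_) (fun u v w => ?_)
      (fun u v w g => ?_) (fun u v w g => ?_)
      (fun u v v' w g g' => funext_three (g.unique g'))
      (fun u v v' w g g' => funext_three (g.unique g'))
    · simp [IsColoring, lineTangle, LineCrossing.pass, kind_heightType, threeColors, f₀, f₁, f₂,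
        Fin.forall_fin_succ, LowerTriangle]
    · simp [IsColoring, lineTangle, LineCrossing.pass, kind_heightType, threeColors, f₀, f₁, f₂,
        Fin.forall_fin_succ, UpperTriangle]
    · obtain ⟨x, y, z, g⟩ := g.exists_upper h₀₁₂
      exact ⟨![x, y, z], g⟩
    · obtain ⟨x, y, z, g⟩ := g.exists_lower h₀₁₂
      exact ⟨![x, y, z], g⟩

theorem LocalMove.sameColors {pseudo : Prop} (hX : pseudo → IsPIAdequate X) {n : ℕ}
    {T T' : Tangle n} (h : LocalMove pseudo n T T') : T.SameColors T' X := by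
  cases h with
  | one fwd t ht => exact sameColors_kink fwd t fun h => hX (ht h)
  | two_a fwd => exact sameColors_bigon_uncrossed fwd .aOver (by simp)
  | two_b fwd => exact sameColors_bigon_uncrossed fwd .bOver (by simp)
  | three fwd h hh => exact sameColors_triangle fwd h hh
  | flatTwist fwd t ht => exact sameColors_flatTwist fwd t ht

end Moves

/-! ### From single moves to links -/

theorem Diagram.Step.nonempty_psyIso {pI : Prop} {D D' : Diagram} (h : Diagram.Step pI D D') :
    Nonempty (PsyIso (Presented D.Arc D.CrossingRel pI) (Presented D'.Arc D'.CrossingRel pI)) := by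
  cases h with
  | iso h =>
    obtain ⟨e⟩ := h
    exact Diagram.nonempty_psyIso_of_extends _ _
      (fun _ _ _ => e.extends (Iso.refl _) (extends_refl _))
      (fun _ _ _ => (Iso.refl _).extends e (extends_refl _))
  | move C _ hT e e' =>
    obtain ⟨e⟩ := e
    obtain ⟨e'⟩ := e'
    exact Diagram.nonempty_psyIso_of_extends _ _
      (fun _ _ hX => e.extends e' ((hT.sameColors hX).1.glue C))
      (fun _ _ hX => e'.extends e ((hT.sameColors hX).2.glue C))

/-- Diagrams of the same link are joined by a finite chain of steps and inverse steps, along which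
isomorphisms compose. -/
theorem Diagram.nonempty_psyIso_of_quot_eq {pI : Prop} {D D' : Diagram}
    (h : Quot.mk (Diagram.Step pI) D = Quot.mk (Diagram.Step pI) D') :
    Nonempty (PsyIso (Presented D.Arc D.CrossingRel pI) (Presented D'.Arc D'.CrossingRel pI)) := by
  replace h := Quot.eqvGen_exact h
  induction h with
  | rel _ _ h => exact h.nonempty_psyIso
  | refl _ => exact ⟨PsyIso.refl _⟩
  | symm _ _ _ ih => exact ih.map PsyIso.symm
  | trans _ _ _ _ _ ih ih' => exact ih.elim fun e => ih'.map e.trans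

end Psy

theorem mainTheorem2 :
    (∀ D D' : Psy.Diagram, D.singularLink = D'.singularLink →
      Nonempty (Psy.PsyIso D.fundamentalPsyquandle D'.fundamentalPsyquandle)) ∧
    (∀ D D' : Psy.Diagram, D.pseudolink = D'.pseudolink →
      Nonempty (Psy.PsyIso D.fundamentalPIPsyquandle D'.fundamentalPIPsyquandle)) :=
  ⟨fun _ _ h => Psy.Diagram.nonempty_psyIso_of_quot_eq h,
    fun _ _ h => Psy.Diagram.nonempty_psyIso_of_quot_eq h⟩
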